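/- Let $k\ge 2$, $m=2k+1$, and let $G=\langle s,t\mid sts\cdots=tst\cdots\ (m\text{ letters on each side})\rangle$ be the Artin group of type $I_2(m)$. Let $M$ be the submonoid of $G$ generated by $\{s,t\}$, $\Omega=sts\cdots$ ($m$ letters), $\Delta=\Omega^2$; let $H=\langle s\rangle$, $G_1=\langle t\rangle$ be the subgroups and $N=\{s^n\mid n\ge 0\}$, $M_1=\{t^n\mid n\ge0\}$ the submonoids generated by $s$ and by $t$, and put $\Lambda=s^2$, $\Delta_1=t^2$, $\theta=\Delta\Delta_1^{-1}$. Definitions. Write $\alpha\le_R\beta$ if $\beta\alpha^{-1}\in M$ and $\alpha\le_L\beta$ if $\alpha^{-1}\beta\in M$. An element $a\in M$ is balanced if $\mathrm{Div}(a)=\{b\in M\mid b\le_R a\}$ equals $\{b\in M\mid b\le_L a\}$. The triple $(G,M,\Delta)$ is a Garside structure if $M\cap M^{-1}=\{1\}$, $\Delta$ is a balanced element of $M$, $M$ is Noetherian (for each $a\in M$ the number of factors in the expressions of $a$ as a product of non-trivial elements of $M$ is bounded), $\mathrm{Div}(\Delta)$ is finite and generates $M$ as a monoid and $G$ as a group,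 and $(G,\le_R)$ is a lattice. A triple $(K,L,\delta)$ is a parabolic substructure if $\delta\in M$ is balanced, $K$ and $L$ are the subgroup and the submonoid generated by $\mathrm{Div}(\delta)$, and $\mathrm{Div}(\delta)=\mathrm{Div}(\Delta)\cap L$. An element $a\in M$ is unmovable if $\Delta\not\le_R a$; the $\Delta$-form of $\alpha\in G$ is the expression $\alpha=a\Delta^{j}$ with $a\in M$ unmovable and $j\in\mathbb Z$. For a parabolic submonoid $L$ of $M$, the $L$-tail of $a\in M$ is the element $b\in L$ with $\{c\in L\mid c\le_R a\}=\{c\in L\mid c\le_R b\}$. Each $a\in M\setminus\{1\}$ has a unique alternating form $a=a_p\cdots a_2a_1$ with $a_p\ne1$, where $a_i$ is the $M_1$-tail (for $i$ odd) or the $N$-tail (for $i$ even) of $a_p\cdots a_i$; put $\mathrm{dpt}(a)=\lfloor p/2\rfloor$, and $\mathrm{dpt}(1)=0$. Let $\Theta=\{\theta^ja_0\in M\mid j\ge1,\ a_0\in M_1\}$ and $\bar\Theta=\Theta\cup M_1$. An element $\alpha\in G$ is $(H,G_1)$-negative if its $\Delta$-form is $\alpha=a\Delta^{-j}$ with $j\ge1$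 and $\mathrm{dpt}(a)<\mathrm{dpt}(\Delta^j)$, and $(H,G_1)$-positive if $\alpha^{-1}$ is $(H,G_1)$-negative; let $P_1$ be the set of $(H,G_1)$-positive elements and $P_1^{-1}$ the set of $(H,G_1)$-negative ones. Then the following hold. (0) $(G,M,\Delta)$ is a Garside structure, $(H,N,\Lambda)$ and $(G_1,M_1,\Delta_1)$ are parabolic substructures of it, $N\ne M$, $M_1\neq M$, $N\cup M_1$ generates $M$, $\Delta$ is central in $G$ and $\Delta_1$ is central in $G_1$. (1) The pair $(H,G_1)$ satisfies Condition A and Condition B with constant $\zeta=2k-1$. That is, (Condition A) $\mathrm{dpt}(\Delta^j)=\zeta j+1$ for all $j\ge1$; and (Condition B) for all unmovable $a,b\in M$ with $(a,b)\notin\bar\Theta\times\bar\Theta$, if $ab=c\Delta^r$ is the $\Delta$-form of $ab$, then there is $\varepsilon\in\{0,1\}$ such that $\mathrm{dpt}(c)=\mathrm{dpt}(a)+\mathrm{dpt}(b)-\zeta r-\varepsilon$, and $\varepsilon=1$ if $a\in\Theta$ or $b\in\Theta$ or $c\in M_1$. (2) $(H,G_1)$ is a Dehornoy structure on $G$: in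 the situation of (0), $P_1P_1\subset P_1$, $G_1P_1G_1\subset P_1$, and $G$ is the disjoint union $P_1\sqcup P_1^{-1}\sqcup G_1$. (3) Let $P_2=\{t^n\mid n\ge1\}$. For each $\epsilon=(\epsilon_1,\epsilon_2)\in\{\pm1\}^2$ the set $P^\epsilon=P_1^{\epsilon_1}\cup P_2^{\epsilon_2}$ is the positive cone $\{g\mid 1<g\}$ of a left-order on $G$ (a strict total order invariant under left multiplication), and these four sets are pairwise distinct. -/

import Mathlib

namespace DehornoyOrder

section Garside

variable {G : Type*} [Group G]

/-- `α ≤_R β` with respect to the submonoid `M`: `β α⁻¹ ∈ M`. -/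
def LeR (M : Submonoid G) (α β : G) : Prop := β * α⁻¹ ∈ M

/-- `α ≤_L β` with respect to the submonoid `M`: `α⁻¹ β ∈ M`. -/
def LeL (M : Submonoid G) (α β : G) : Prop := α⁻¹ * β ∈ M

/-- The right divisors of `a` in `M`. -/
def DivR (M : Submonoid G) (a : G) : Set G := {b | b ∈ M ∧ LeR M b a}

/-- The left divisors of `a` in `M`. -/
def DivL (M : Submonoid G) (a : G) : Set G := {b | b ∈ M ∧ LeL M b a}

/-- `a` is a balanced element of `M`. Its set of divisors `Div a` is then `DivR M a`. -/
def IsBalanced (M : Submonoid G) (a : G) : Prop := a ∈ M ∧ DivR M a = DivL M a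

/-- `M` is Noetherian: for each `a ∈ M` there is `n ≥ 1` such that `a` is not a product of more
than `n` non-trivial elements of `M`. -/
def IsNoetherianMonoid (M : Submonoid G) : Prop :=
  ∀ a ∈ M, ∃ n : ℕ, 1 ≤ n ∧
    ∀ l : List G, (∀ x ∈ l, x ∈ M ∧ x ≠ 1) → l.prod = a → l.length ≤ n

/-- `(G, M, Δ)` is a Garside structure on `G`. -/
structure IsGarsideStructure (M : Submonoid G) (Δ : G) : Prop where
  eq_one_of_mem_of_inv_mem : ∀ a ∈ M, a⁻¹ ∈ M → a = 1
  balanced : IsBalanced M Δ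
  noetherian : IsNoetherianMonoid M
  finite_div : (DivR M Δ).Finite
  monoid_closure_div : Submonoid.closure (DivR M Δ) = M
  group_closure_div : Subgroup.closure (DivR M Δ) = ⊤
  exists_inf : ∀ α β : G, ∃ γ, LeR M γ α ∧ LeR M γ β ∧
    ∀ δ, LeR M δ α → LeR M δ β → LeR M δ γ
  exists_sup : ∀ α β : G, ∃ γ, LeR M α γ ∧ LeR M β γ ∧
    ∀ δ, LeR M α δ → LeR M β δ → LeR M γ δ

/-- `(K, N, δ)` is a parabolic substructure of `(G, M, Δ)`: the element `δ` of `M` is balanced,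
`K` and `N` are the subgroup and the submonoid generated by `Div δ`, and
`Div δ = Div Δ ∩ N`. -/
structure IsParabolicSubstructure (M : Submonoid G) (Δ : G)
    (K : Subgroup G) (N : Submonoid G) (δ : G) : Prop where
  balanced : IsBalanced M δ
  subgroup_eq : K = Subgroup.closure (DivR M δ)
  submonoid_eq : N = Submonoid.closure (DivR M δ)
  div_eq : DivR M δ = DivR M Δ ∩ (N : Set G)

/-- `a` is an unmovable element of `M`. -/
def IsUnmovable (M : Submonoid G) (Δ a : G) : Prop := a ∈ M ∧ ¬ LeR M Δ a

/-- `α = a Δ ^ k` is the (right) `Δ`-form of `α`. -/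
def IsDeltaForm (M : Submonoid G) (Δ α a : G) (k : ℤ) : Prop :=
  IsUnmovable M Δ a ∧ α = a * Δ ^ k

/-- `b` is the (right) `N`-tail of `a`: the element of `N` such that
`{c ∈ N | c ≤_R a} = {c ∈ N | c ≤_R b}`. -/
def IsTail (M N : Submonoid G) (a b : G) : Prop :=
  b ∈ N ∧ {c | c ∈ N ∧ LeR M c a} = {c | c ∈ N ∧ LeR M c b}

/-- The list `[a_1, a_2, …, a_p]` is the (right) alternating form `a = a_p ⋯ a_2 a_1` of `a`
with respect to `(N₂, N₁)`: `a_p ≠ 1`, and `a_i` is the `N₁`-tail (for `i` odd) or the `N₂`-tail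
(for `i` even) of `a_p ⋯ a_i`. The list is indexed from `0`, so `a_(i+1)` is `l[i]`. -/
structure IsAlternatingForm (M N₂ N₁ : Submonoid G) (a : G) (l : List G) : Prop where
  ne_nil : l ≠ []
  last_ne_one : l.getLast ne_nil ≠ 1
  prod_eq : l.reverse.prod = a
  odd_tail : ∀ (i : ℕ) (hi : i < l.length), Odd (i + 1) →
    IsTail M N₁ (l.drop i).reverse.prod l[i]
  even_tail : ∀ (i : ℕ) (hi : i < l.length), Even (i + 1) →
    IsTail M N₂ (l.drop i).reverse.prod l[i]

open Classical in
/-- The `(N₂, N₁)`-breadth of `a ∈ M`: the length of the alternating form of `a`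
(which is unique), and `1` for `a = 1`. -/
noncomputable def breadth (M N₂ N₁ : Submonoid G) (a : G) : ℕ :=
  if a = 1 then 1 else sInf {p | ∃ l : List G, IsAlternatingForm M N₂ N₁ a l ∧ l.length = p}

/-- The depth of `a ∈ M`: `(bh a - 1) / 2` if the breadth is odd, `bh a / 2` if it is even. -/
noncomputable def depth (M N₂ N₁ : Submonoid G) (a : G) : ℕ :=
  if Odd (breadth M N₂ N₁ a) then (breadth M N₂ N₁ a - 1) / 2 else breadth M N₂ N₁ a / 2

end Garside

/-- The data of two triples `(H, N, Λ)` and `(G₁, M₁, Δ₁)` inside a triple `(G, M, Δ)`. -/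
structure GarsidePair (G : Type*) [Group G] where
  M : Submonoid G
  Δ : G
  H : Subgroup G
  N : Submonoid G
  Λ : G
  G₁ : Subgroup G
  M₁ : Submonoid G
  Δ₁ : G

namespace GarsidePair

variable {G : Type*} [Group G] (D : GarsidePair G)

/-- The standing assumptions on a pair of parabolic substructures of a Garside structure under
which the notions below are considered. -/
structure IsAdmissible : Prop where
  garside : IsGarsideStructure D.M D.Δ
  parabolic_H : IsParabolicSubstructure D.M D.Δ D.H D.N D.Λ
  parabolic_G₁ : IsParabolicSubstructure D.M D.Δ D.G₁ D.M₁ D.Δ₁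
  N_ne : D.N ≠ D.M
  M₁_ne : D.M₁ ≠ D.M
  generate : Submonoid.closure ((D.N : Set G) ∪ (D.M₁ : Set G)) = D.M
  Δ_central : ∀ g : G, D.Δ * g = g * D.Δ
  Δ₁_central : ∀ g ∈ D.G₁, D.Δ₁ * g = g * D.Δ₁

/-- The depth with respect to `(N, M₁)`. -/
noncomputable def dpt (a : G) : ℕ := depth D.M D.N D.M₁ a

/-- The set `P⁻¹` of `(H, G₁)`-negative elements: those `α` whose `Δ`-form is
`α = a Δ ^ (-k)` with `k ≥ 1` and `dpt a < dpt (Δ ^ k)`. -/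
def negative : Set G :=
  {α | ∃ (a : G) (k : ℕ), IsDeltaForm D.M D.Δ α a (-(k : ℤ)) ∧ 1 ≤ k ∧ D.dpt a < D.dpt (D.Δ ^ k)}

/-- The set `P` of `(H, G₁)`-positive elements. -/
def positive : Set G := {α | α⁻¹ ∈ D.negative}

/-- `(H, G₁)` is a Dehornoy structure on `(G, M, Δ)`. -/
structure IsDehornoyStructure : Prop where
  admissible : D.IsAdmissible
  mul_mem : ∀ α ∈ D.positive, ∀ β ∈ D.positive, α * β ∈ D.positive
  mul_mul_mem : ∀ γ ∈ D.G₁, ∀ α ∈ D.positive, ∀ γ' ∈ D.G₁, γ * α * γ' ∈ D.positive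
  cover : D.positive ∪ D.negative ∪ (D.G₁ : Set G) = Set.univ
  disjoint_pos_neg : Disjoint D.positive D.negative
  disjoint_pos_G₁ : Disjoint D.positive (D.G₁ : Set G)
  disjoint_neg_G₁ : Disjoint D.negative (D.G₁ : Set G)

/-- Condition A with constant `ζ`. -/
def ConditionA (ζ : ℕ) : Prop := 1 ≤ ζ ∧ ∀ k : ℕ, 1 ≤ k → D.dpt (D.Δ ^ k) = ζ * k + 1

/-- The element `θ = Δ Δ₁⁻¹`. -/
def θ : G := D.Δ * D.Δ₁⁻¹

/-- The set `Θ` of theta elements of `M`. -/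
def Theta : Set G := {a | a ∈ D.M ∧ ∃ k : ℕ, 1 ≤ k ∧ ∃ a₀ ∈ D.M₁, a = D.θ ^ k * a₀}

/-- The set `Θ ∪ M₁`. -/
def ThetaBar : Set G := D.Theta ∪ (D.M₁ : Set G)

/-- Condition B with constant `ζ`. -/
def ConditionB (ζ : ℕ) : Prop :=
  1 ≤ ζ ∧ ∀ a b : G, IsUnmovable D.M D.Δ a → IsUnmovable D.M D.Δ b →
    ¬ (a ∈ D.ThetaBar ∧ b ∈ D.ThetaBar) →
    ∀ (c : G) (t : ℤ), IsDeltaForm D.M D.Δ (a * b) c t →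
      ∃ ε : ℤ, (ε = 0 ∨ ε = 1) ∧
        (D.dpt c : ℤ) = (D.dpt a : ℤ) + (D.dpt b : ℤ) - (ζ : ℤ) * t - ε ∧
        (a ∈ D.Theta ∨ b ∈ D.Theta ∨ c ∈ D.M₁ → ε = 1)

end GarsidePair

/-- `P` is the positive cone `{g | 1 < g}` of a left-order on `G`, that is, of a strict total order
invariant under left multiplication. -/
def IsPositiveConeOfLeftOrder {G : Type*} [Group G] (P : Set G) : Prop :=
  ∃ lt : G → G → Prop,
    (∀ a, ¬ lt a a) ∧ (∀ a b c, lt a b → lt b c → lt a c) ∧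
    (∀ a b, lt a b ∨ a = b ∨ lt b a) ∧
    (∀ a b c, lt b c → lt (a * b) (a * c)) ∧
    P = {g | lt 1 g}

/-- `P ^ e` for a sign `e`: it is `P` for `e = 1` and the set of inverses for `e = -1`. -/
def signedSet {G : Type*} [Group G] (e : ℤˣ) (P : Set G) : Set G := {g | g ^ (e : ℤ) ∈ P}

/-- The alternating product `x y x ⋯` with `n` factors. -/
def altProd {G : Type*} [Monoid G] (x y : G) : ℕ → G
  | 0 => 1
  | n + 1 => x * altProd y x n

/-- The Artin group of type `I₂(m)`: generators `s = 0`, `t = 1` and the single relation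
`s t s ⋯ = t s t ⋯` with `m` factors on each side. -/
abbrev DihedralArtin (m : ℕ) : Type :=
  PresentedGroup
    ({altProd (FreeGroup.of 0) (FreeGroup.of 1) m *
      (altProd (FreeGroup.of 1) (FreeGroup.of 0) m)⁻¹} : Set (FreeGroup (Fin 2)))

namespace DihedralArtin

/-- The generator `s`. -/
def s (m : ℕ) : DihedralArtin m := PresentedGroup.of 0

/-- The generator `t`. -/
def t (m : ℕ) : DihedralArtin m := PresentedGroup.of 1

/-- The element `Ω = s t s ⋯` with `m` factors. -/
def Ω (m : ℕ) : DihedralArtin m := altProd (s m) (t m) m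

/-- The pair `H = ⟨s⟩`, `G₁ = ⟨t⟩` in the Artin group of type `I₂(m)` with Garside element
`Δ = Ω ^ 2`; here `Λ = s ^ 2` and `Δ₁ = t ^ 2`. -/
def pair (m : ℕ) : GarsidePair (DihedralArtin m) where
  M := Submonoid.closure {s m, t m}
  Δ := Ω m ^ 2
  H := Subgroup.zpowers (s m)
  N := Submonoid.powers (s m)
  Λ := s m ^ 2
  G₁ := Subgroup.zpowers (t m)
  M₁ := Submonoid.powers (t m)
  Δ₁ := t m ^ 2

/-- The set `P ^ ε = P₁ ^ ε₁ ∪ P₂ ^ ε₂`, where `P₁` is the set of `(H, G₁)`-positive elements and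
`P₂ = {t ^ n | n ≥ 1}`. -/
def cone (m : ℕ) (ε : ℤˣ × ℤˣ) : Set (DihedralArtin m) :=
  signedSet ε.1 (pair m).positive ∪ signedSet ε.2 {g | ∃ n : ℕ, 1 ≤ n ∧ g = t m ^ n}

end DihedralArtin

end DehornoyOrder

/-!
Put `m = 2k + 1` and `ζ = 2k - 1`. The proof rests on an action of the Artin group on a line. Modulo
its center the group is the free product of a cyclic group of order `m`, generated by the image of
`st`, and a group of order `2`, generated by the image of `Ω`. This quotient acts on a circle in the
manner of a triangle group `(2, m, ∞)`: an arc rotation of order `m` permutes `m` arcs, and a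
half-turn exchanges one of the arcs with the union of the others. On the universal cover, the lifts
`r` and `y` of these two maps satisfy `y ^ 2 = r ^ m`, so that `s ↦ r⁻¹ y`, `t ↦ y r⁻¹` defines an
action of the whole group by increasing maps, which commutes with the full turn `r ^ m` and in which
`Δ` acts as `ζ` full turns. Iterating the half-turn subdivides each arc into `m - 1` arcs again, so
the line is encoded by an integer followed by a sequence of digits (`Line`), in lexicographic order,
on which the half-turn (`Line.half`) removes or adds a leading digit.

*Normal forms.* A positive word without an alternating factor of length `m` moves a special point to
a position that shows its first letter (`position_ev`). So different words of this kind represent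
different elements (`eq_of_ev_mul_eq`), and these words have no other positive representative
(`eq_of_ev_eq`). Hence an element that is divisible by both generators is divisible by `Ω`, which
gives greatest common divisors by induction on the length, and the lattice property; the parabolic
substructures and the tails in the submonoids generated by `s` and by `t` can be read off as well.

*Depth.* The generator `t` fixes the point `base`. A positive element is `a = u t^n` with a reduced
word `u` that does not end in `t`; its depth is the number of blocks of letters `s` in `u`. The word
`u` with `N ≥ 1` such blocks moves the base point by at least `N - 1` and by less than `N` full
turns. So the depth of `a ∉ M₁` is `level a + 1`, where `level a` is the number of full turns,
rounded down, between the base point and its image (`dpt_of_notMem`). Condition A follows, as `Δ`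
acts as `ζ` full turns.

*Condition B.* As the action is increasing and commutes with full turns, `level` is additive up to an
error in `{0, 1}`. The error vanishes if one factor moves the base point by full turns; such a
positive element is a product of a power of `θ` and a power of `t` (`exists_eq_θ_pow_mul`), that is,
an element of `Θ ∪ M₁`. The remaining claim, for `c ∈ M₁`, is the value of `level` at an inverse.

*Orders.* The negative and the positive elements are those that move the base point down and up
(`mem_negative_iff`, `mem_positive_iff`), and `G₁` is the stabilizer of the base point
(`act_base_eq_iff`). So the Dehornoy structure expresses that the line is totally ordered, and the
four cones are obtained from the order on the orbit and the order on the stabilizer, each of which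
can be reversed.
-/

namespace DehornoyOrder

/-! ### The linearly ordered set of digit sequences -/

/-- Sequences with digits `0, …, m`, where `m = 2 * k + 1`, in lexicographic order. -/
abbrev Digits (k : ℕ) : Type := Lex (ℕ → Fin (2 * k + 2))

namespace Digits

variable {k : ℕ}

/-- The sequence with first digit `d` followed by `σ`. -/
def cons (d : Fin (2 * k + 2)) (σ : Digits k) : Digits k :=
  toLex fun n => Nat.casesOn n d (ofLex σ)

/-- The first digit of a sequence. -/
def head (σ : Digits k) : Fin (2 * k + 2) := ofLex σ 0

/-- The sequence without its first digit. -/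
def tail (σ : Digits k) : Digits k := toLex fun n => ofLex σ (n + 1)

@[simp] theorem head_cons (d : Fin (2 * k + 2)) (σ : Digits k) : (cons d σ).head = d := rfl

@[simp] theorem tail_cons (d : Fin (2 * k + 2)) (σ : Digits k) : (cons d σ).tail = σ := rfl

theorem cons_head_tail (σ : Digits k) : cons σ.head σ.tail = σ := by
  funext n
  cases n <;> rfl

theorem lt_iff (σ τ : Digits k) :
    σ < τ ↔ σ.head < τ.head ∨ σ.head = τ.head ∧ σ.tail < τ.tail := by
  constructor
  · rintro ⟨i, hi, hlt⟩
    cases i with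
    | zero => exact Or.inl hlt
    | succ i => exact Or.inr ⟨hi 0 i.succ_pos, i, fun j hj => hi (j + 1) (by omega), hlt⟩
  · rintro (h | ⟨h, i, hi, hlt⟩)
    · exact ⟨0, fun j hj => absurd hj (by simp), h⟩
    · refine ⟨i + 1, fun j hj => ?_, hlt⟩
      cases j with
      | zero => exact h
      | succ j => exact hi j (by simpa using hj)

end Digits

/-- The line: an integer followed by a sequence of digits, in lexicographic order. It stands for
the universal cover of a circle that is cut into `m = 2 * k + 1` arcs; the integer is the number of
the arc, and the digits locate a point in the arc. -/
abbrev Line (k : ℕ) : Type := ℤ ×ₗ Digits k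

namespace Line

open Digits

variable {k : ℕ}

/-- The point with arc number `n` and digits `σ`. -/
def mk (n : ℤ) (σ : Digits k) : Line k := toLex (n, σ)

/-- The arc number of a point. -/
def arc (x : Line k) : ℤ := (ofLex x).1

/-- The digits of a point. -/
def digits (x : Line k) : Digits k := (ofLex x).2

@[simp] theorem arc_mk (n : ℤ) (σ : Digits k) : (mk n σ).arc = n := rfl

@[simp] theorem digits_mk (n : ℤ) (σ : Digits k) : (mk n σ).digits = σ := rfl

theorem lt_iff (x y : Line k) :
    x < y ↔ x.arc < y.arc ∨ x.arc = y.arc ∧ x.digits < y.digits :=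
  Prod.Lex.lt_iff

@[ext] theorem ext {x y : Line k} (h₁ : x.arc = y.arc) (h₂ : x.digits = y.digits) : x = y :=
  Prod.ext h₁ h₂

/-- Translation by `a` arcs. -/
def shift (a : ℤ) (x : Line k) : Line k := mk (x.arc + a) x.digits

@[simp] theorem arc_shift (a : ℤ) (x : Line k) : (shift a x).arc = x.arc + a := rfl

@[simp] theorem digits_shift (a : ℤ) (x : Line k) : (shift a x).digits = x.digits := rfl

/-- The rotation by one arc. -/
noncomputable def rot (k : ℕ) : Line k ≃o Line k :=
  StrictMono.orderIsoOfRightInverse (shift 1)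
    (fun x y h => by simpa [lt_iff] using h) (shift (-1)) (fun x => by ext <;> simp)

theorem rot_apply (x : Line k) : rot k x = shift 1 x := rfl

theorem rot_zpow_apply (n : ℤ) (x : Line k) : (rot k ^ n) x = shift n x := by
  induction n using Int.induction_on generalizing x with
  | zero => ext <;> simp
  | succ n ih => rw [zpow_add, zpow_one, RelIso.mul_apply, ih, rot_apply]; ext <;> simp; ring
  | pred n ih =>
    have h : (rot k)⁻¹ x = shift (-1) x := rfl
    rw [zpow_sub, zpow_one, RelIso.mul_apply, ih, h]
    ext <;> simp; ring

/-- The half-turn, as a function. It expands the `0`-th arc (the points with digits `1, …, m - 1`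
at first place) onto the union of the following `m - 1` arcs, and it contracts the latter onto the
`m`-th arc. The digits `0` and `m` are endpoints that are moved to each other; they make the action
free enough for the uniqueness of normal forms. -/
def halfFun (x : Line k) : Line k :=
  if x.arc % (2 * k + 1) = 0 then
    if x.digits.head = 0 then mk x.arc (cons (Fin.last _) x.digits.tail)
    else if x.digits.head = Fin.last _ then mk (x.arc + (2 * k + 1)) (cons 0 x.digits.tail)
    else mk (x.arc + x.digits.head) x.digits.tail
  else
    mk (x.arc - x.arc % (2 * k + 1) + (2 * k + 1))
      (cons (Fin.ofNat _ (x.arc % (2 * k + 1)).toNat) x.digits)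

theorem coe_ofNat_emod (n : ℤ) :
    ((Fin.ofNat (2 * k + 2) (n % (2 * k + 1)).toNat : Fin (2 * k + 2)) : ℤ) =
      n % (2 * k + 1) := by
  have h₀ := Int.emod_nonneg n (show (2 * k + 1 : ℤ) ≠ 0 by omega)
  have h₁ := Int.emod_lt_of_pos n (show (0 : ℤ) < 2 * k + 1 by omega)
  rw [Fin.ofNat_eq_cast, Fin.val_natCast, Nat.mod_eq_of_lt (by omega)]
  omega

theorem halfFun_zero (x : Line k) (h : x.arc % (2 * k + 1) = 0) (h₀ : (x.digits.head : ℕ) = 0) :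
    halfFun x = mk x.arc (cons (Fin.last _) x.digits.tail) := by
  rw [halfFun, if_pos h, if_pos (Fin.ext h₀)]

theorem halfFun_last (x : Line k) (h : x.arc % (2 * k + 1) = 0)
    (h₀ : (x.digits.head : ℕ) = 2 * k + 1) :
    halfFun x = mk (x.arc + (2 * k + 1)) (cons 0 x.digits.tail) := by
  rw [halfFun, if_pos h, if_neg, if_pos (Fin.ext h₀)]
  intro h'; rw [h'] at h₀; simp at h₀

theorem halfFun_mid (x : Line k) (h : x.arc % (2 * k + 1) = 0) (h₀ : (x.digits.head : ℕ) ≠ 0)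
    (h₁ : (x.digits.head : ℕ) ≠ 2 * k + 1) :
    halfFun x = mk (x.arc + x.digits.head) x.digits.tail := by
  rw [halfFun, if_pos h, if_neg, if_neg]
  · intro h'; exact h₁ (by rw [h']; rfl)
  · intro h'; exact h₀ (by rw [h']; rfl)

theorem halfFun_out (x : Line k) (h : x.arc % (2 * k + 1) ≠ 0) :
    ∃ d : Fin (2 * k + 2), (d : ℤ) = x.arc % (2 * k + 1) ∧
      halfFun x = mk (x.arc - x.arc % (2 * k + 1) + (2 * k + 1)) (cons d x.digits) :=
  ⟨_, coe_ofNat_emod _, by rw [halfFun, if_neg h]⟩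

/-- The four kinds of points for the half-turn, in terms of arc numbers and digits. -/
theorem halfFun_cases (x : Line k) :
    (x.arc % (2 * k + 1) = 0 ∧ (x.digits.head : ℕ) = 0 ∧ (halfFun x).arc = x.arc ∧
      ((halfFun x).digits.head : ℕ) = 2 * k + 1 ∧ (halfFun x).digits.tail = x.digits.tail) ∨
    (x.arc % (2 * k + 1) = 0 ∧ (x.digits.head : ℕ) = 2 * k + 1 ∧
      (halfFun x).arc = x.arc + (2 * k + 1) ∧
      ((halfFun x).digits.head : ℕ) = 0 ∧ (halfFun x).digits.tail = x.digits.tail) ∨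
    (x.arc % (2 * k + 1) = 0 ∧ (x.digits.head : ℕ) ≠ 0 ∧ (x.digits.head : ℕ) < 2 * k + 1 ∧
      (halfFun x).arc = x.arc + (x.digits.head : ℕ) ∧ (halfFun x).digits = x.digits.tail) ∨
    (x.arc % (2 * k + 1) ≠ 0 ∧ (halfFun x).arc = x.arc - x.arc % (2 * k + 1) + (2 * k + 1) ∧
      (((halfFun x).digits.head : ℕ) : ℤ) = x.arc % (2 * k + 1) ∧
      (halfFun x).digits.tail = x.digits) := by
  by_cases h : x.arc % (2 * k + 1) = 0
  · by_cases h₀ : (x.digits.head : ℕ) = 0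
    · left; rw [halfFun_zero x h h₀]; simp [h, h₀]
    · by_cases h₁ : (x.digits.head : ℕ) = 2 * k + 1
      · right; left; rw [halfFun_last x h h₁]; simp [h, h₁]
      · right; right; left; rw [halfFun_mid x h h₀ h₁]
        have := x.digits.head.isLt
        refine ⟨h, h₀, by omega, rfl, rfl⟩
  · obtain ⟨d, hd, e⟩ := halfFun_out x h
    right; right; right; rw [e]
    exact ⟨h, rfl, by simpa using hd, rfl⟩

theorem digits_ext {σ τ : Digits k} (h : (σ.head : ℕ) = τ.head) (h' : σ.tail = τ.tail) :
    σ = τ := by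
  rw [← cons_head_tail σ, ← cons_head_tail τ, Fin.ext h, h']

theorem arc_halfFun_emod (a : ℤ) (d : ℕ) (h : a % (2 * k + 1) = 0) (hd : d < 2 * k + 1) :
    (a + d) % (2 * k + 1) = d := by
  rw [Int.add_emod, h, zero_add, Int.emod_emod]
  exact Int.emod_eq_of_lt (by omega) (by omega)

theorem emod_sub_add (a : ℤ) : (a - a % (2 * k + 1) + (2 * k + 1)) % (2 * k + 1) = 0 := by
  have := Int.mul_ediv_add_emod a (2 * k + 1)
  rw [show a - a % (2 * k + 1) + (2 * k + 1) = (2 * k + 1) * (a / (2 * k + 1) + 1) by linarith]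
  exact Int.mul_emod_right _ _

theorem halfFun_halfFun (x : Line k) : halfFun (halfFun x) = shift (2 * k + 1) x := by
  rcases halfFun_cases x with ⟨h, h₀, e₁, e₂, e₃⟩ | ⟨h, h₀, e₁, e₂, e₃⟩ | ⟨h, h₀, h₁, e₁, e₂⟩ |
    ⟨h, e₁, e₂, e₃⟩
  · rw [halfFun_last _ (by rw [e₁, h]) e₂]
    ext
    · simp [e₁]
    · exact digits_ext (by simp [h₀]) (by simp [e₃])
  · rw [halfFun_zero _ (by rw [e₁]; simp [h]) e₂]
    ext
    · simp [e₁]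
    · exact digits_ext (by simp [h₀]) (by simp [e₃])
  · have h2 : (halfFun x).arc % (2 * k + 1) = (x.digits.head : ℕ) := by
      rw [e₁]; exact arc_halfFun_emod _ _ h h₁
    obtain ⟨d, hd, e⟩ := halfFun_out (halfFun x) (by rw [h2]; exact_mod_cast h₀)
    rw [e]
    ext
    · rw [h2, e₁]; simp only [arc_mk, arc_shift]; ring
    · refine digits_ext ?_ (by simp [e₂])
      simp only [digits_mk, head_cons, digits_shift]
      rw [h2] at hd; exact_mod_cast hd
  · have h0 := Int.emod_nonneg x.arc (show (2 * k + 1 : ℤ) ≠ 0 by omega)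
    have h1 := Int.emod_lt_of_pos x.arc (show (0 : ℤ) < 2 * k + 1 by omega)
    rw [halfFun_mid _ (by rw [e₁]; exact emod_sub_add _) (by omega) (by omega)]
    ext
    · simp only [arc_mk, e₁, arc_shift, e₂]; ring
    · simp [e₃]

/-- The exceptional digits are the least and the greatest one, so that the half-turn is increasing on
the whole line. -/
theorem halfFun_strictMono : StrictMono (halfFun : Line k → Line k) := by
  intro x y h
  have hx := Int.mul_ediv_add_emod x.arc (2 * k + 1)
  have hy := Int.mul_ediv_add_emod y.arc (2 * k + 1)
  have hx0 := Int.emod_nonneg x.arc (show (2 * k + 1 : ℤ) ≠ 0 by omega)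
  have hx1 := Int.emod_lt_of_pos x.arc (show (0 : ℤ) < 2 * k + 1 by omega)
  have hy0 := Int.emod_nonneg y.arc (show (2 * k + 1 : ℤ) ≠ 0 by omega)
  have hy1 := Int.emod_lt_of_pos y.arc (show (0 : ℤ) < 2 * k + 1 by omega)
  -- either both points lie in the same fundamental domain of the full turn, or `x` precedes
  have hdiv : x.arc / (2 * k + 1) = y.arc / (2 * k + 1) ∨
      x.arc - x.arc % (2 * k + 1) + (2 * k + 1) ≤ y.arc - y.arc % (2 * k + 1) := by
    have hle : x.arc ≤ y.arc := by rcases (lt_iff x y).1 h with h | h <;> omega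
    rcases (Int.ediv_le_ediv (show (0 : ℤ) < 2 * k + 1 by omega) hle).eq_or_lt with h' | h'
    · exact Or.inl h'
    · right
      have : (2 * k + 1 : ℤ) * (x.arc / (2 * k + 1) + 1) ≤ (2 * k + 1) * (y.arc / (2 * k + 1)) :=
        mul_le_mul_of_nonneg_left h' (by omega)
      linarith
  have hdx := x.digits.head.isLt
  have hdy := y.digits.head.isLt
  rw [lt_iff] at h
  rw [lt_iff]
  have l₁ := Digits.lt_iff x.digits y.digits
  have l₂ := Digits.lt_iff (halfFun x).digits (halfFun y).digits
  simp only [Fin.lt_def, Fin.ext_iff] at l₁ l₂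
  rcases hdiv with hd | hd
  · have hd' : x.arc - x.arc % (2 * k + 1) = y.arc - y.arc % (2 * k + 1) := by
      rw [hd] at hx; linarith
    rcases halfFun_cases x with ⟨a, a₀, e₁, e₂, e₃⟩ | ⟨a, a₀, e₁, e₂, e₃⟩ |
      ⟨a, a₀, a₁, e₁, e₂⟩ | ⟨a, e₁, e₂, e₃⟩ <;>
    rcases halfFun_cases y with ⟨b, b₀, f₁, f₂, f₃⟩ | ⟨b, b₀, f₁, f₂, f₃⟩ |
      ⟨b, b₀, b₁, f₁, f₂⟩ | ⟨b, f₁, f₂, f₃⟩ <;>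
    grind
  · rcases halfFun_cases x with ⟨a, a₀, e₁, e₂, e₃⟩ | ⟨a, a₀, e₁, e₂, e₃⟩ |
      ⟨a, a₀, a₁, e₁, e₂⟩ | ⟨a, e₁, e₂, e₃⟩ <;>
    rcases halfFun_cases y with ⟨b, b₀, f₁, f₂, f₃⟩ | ⟨b, b₀, f₁, f₂, f₃⟩ |
      ⟨b, b₀, b₁, f₁, f₂⟩ | ⟨b, f₁, f₂, f₃⟩ <;>
    grind

/-- The half-turn. -/
noncomputable def half (k : ℕ) : Line k ≃o Line k :=
  StrictMono.orderIsoOfRightInverse halfFun halfFun_strictMono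
    (fun x => halfFun (shift (-(2 * k + 1)) x))
    (fun x => by rw [halfFun_halfFun]; ext <;> simp; ring)

theorem half_apply (x : Line k) : half k x = halfFun x := rfl

theorem half_mul_half : half k * half k = rot k ^ (2 * k + 1 : ℤ) := by
  refine RelIso.ext fun x => ?_
  rw [RelIso.mul_apply, half_apply, half_apply, halfFun_halfFun, rot_zpow_apply]

end Line

/-! ### Alternating products -/

theorem map_altProd {G G' : Type*} [Monoid G] [Monoid G'] (f : G →* G') (x y : G) (n : ℕ) :
    f (altProd x y n) = altProd (f x) (f y) n := by
  induction n generalizing x y with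
  | zero => exact map_one f
  | succ n ih => rw [altProd, map_mul, ih, altProd]

theorem altProd_self {G : Type*} [Monoid G] (x : G) (n : ℕ) : altProd x x n = x ^ n := by
  induction n with
  | zero => rw [pow_zero]; rfl
  | succ n ih => rw [altProd, ih, pow_succ']

theorem altProd_two_mul {G : Type*} [Monoid G] (x y : G) (n : ℕ) :
    altProd x y (2 * n) = (x * y) ^ n := by
  induction n with
  | zero => rw [pow_zero]; rfl
  | succ n ih => rw [show 2 * (n + 1) = 2 * n + 1 + 1 by ring, altProd, altProd, ih, pow_succ',
      mul_assoc]

theorem altProd_two_mul_add_one {G : Type*} [Monoid G] (x y : G) (n : ℕ) :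
    altProd x y (2 * n + 1) = altProd x y (2 * n) * x := by
  induction n with
  | zero => simp [altProd]
  | succ n ih =>
    rw [show 2 * (n + 1) + 1 = 2 * n + 1 + 1 + 1 by ring,
      show 2 * (n + 1) = 2 * n + 1 + 1 by ring, altProd, altProd, ih, altProd, altProd]
    simp only [mul_assoc]

theorem mul_altProd_odd {G : Type*} [Monoid G] (x y : G) (n : ℕ) :
    x * altProd y x (2 * n + 1) = altProd x y (2 * n + 1) * y := by
  have h : x * altProd y x (2 * n + 1) = altProd x y (2 * (n + 1)) := rfl
  rw [h, altProd_two_mul_add_one, altProd_two_mul, altProd_two_mul, pow_succ, mul_assoc]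

namespace DihedralArtin

variable {k : ℕ}

/-! ### The defining relation and the homomorphisms out of the group -/

/-- The generators, `s` for `true` and `t` for `false`. -/
def gen (k : ℕ) (e : Bool) : DihedralArtin (2 * k + 1) := if e then s _ else t _

@[simp] theorem gen_true : gen k true = s (2 * k + 1) := rfl

@[simp] theorem gen_false : gen k false = t (2 * k + 1) := rfl

theorem altProd_s_t (m : ℕ) : altProd (s m) (t m) m = altProd (t m) (s m) m := by
  have h := PresentedGroup.one_of_mem (rels := ({altProd (FreeGroup.of 0) (FreeGroup.of 1) m *
      (altProd (FreeGroup.of 1) (FreeGroup.of 0) m)⁻¹} : Set (FreeGroup (Fin 2))))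
      (Set.mem_singleton _)
  rw [map_mul, map_inv, map_altProd, map_altProd, mul_inv_eq_one] at h
  exact h

theorem altProd_gen (e : Bool) : altProd (gen k e) (gen k !e) (2 * k + 1) = Ω (2 * k + 1) := by
  cases e
  · exact (altProd_s_t _).symm
  · rfl

theorem gen_mul_Ω (e : Bool) : gen k e * Ω (2 * k + 1) = Ω (2 * k + 1) * gen k !e := by
  have h := mul_altProd_odd (gen k e) (gen k !e) k
  have h' := altProd_gen (k := k) (!e)
  rw [Bool.not_not] at h'
  rw [altProd_gen e] at h
  exact h' ▸ h

theorem gen_mul_Δ (e : Bool) : gen k e * Ω (2 * k + 1) ^ 2 = Ω (2 * k + 1) ^ 2 * gen k e := by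
  rw [pow_two, ← mul_assoc, gen_mul_Ω, mul_assoc, gen_mul_Ω, Bool.not_not, mul_assoc]

theorem closure_gen : Subgroup.closure (Set.range (gen k)) = ⊤ := by
  rw [eq_top_iff, ← PresentedGroup.closure_range_of, Subgroup.closure_le]
  rintro _ ⟨i, rfl⟩
  refine Subgroup.subset_closure ?_
  fin_cases i
  · exact ⟨true, rfl⟩
  · exact ⟨false, rfl⟩

theorem Δ_mul_comm (g : DihedralArtin (2 * k + 1)) :
    Ω (2 * k + 1) ^ 2 * g = g * Ω (2 * k + 1) ^ 2 := by
  have h : g ∈ Subgroup.closure (Set.range (gen k)) := by rw [closure_gen]; trivial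
  have hle : Subgroup.closure (Set.range (gen k)) ≤ Subgroup.centralizer {Ω (2 * k + 1) ^ 2} := by
    rw [Subgroup.closure_le]
    rintro _ ⟨e, rfl⟩
    rw [SetLike.mem_coe, Subgroup.mem_centralizer_singleton_iff]
    exact gen_mul_Δ e
  exact (Subgroup.mem_centralizer_singleton_iff.1 (hle h)).symm

/-- A homomorphism out of the group, from two elements that satisfy the relation. -/
def lift {G' : Type*} [Group G'] (x y : G')
    (h : altProd x y (2 * k + 1) = altProd y x (2 * k + 1)) : DihedralArtin (2 * k + 1) →* G' :=
  PresentedGroup.toGroup (f := ![x, y]) (by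
    rintro _ rfl
    rw [map_mul, map_inv, map_altProd, map_altProd, mul_inv_eq_one]
    simpa using h)

@[simp] theorem lift_s {G' : Type*} [Group G'] (x y : G')
    (h : altProd x y (2 * k + 1) = altProd y x (2 * k + 1)) : lift x y h (s _) = x :=
  PresentedGroup.toGroup.of _

@[simp] theorem lift_t {G' : Type*} [Group G'] (x y : G')
    (h : altProd x y (2 * k + 1) = altProd y x (2 * k + 1)) : lift x y h (t _) = y :=
  PresentedGroup.toGroup.of _

/-- The homomorphism to `ℤ` that maps both generators to `1`, written multiplicatively. -/
def lengthHom (k : ℕ) : DihedralArtin (2 * k + 1) →* Multiplicative ℤ :=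
  lift (Multiplicative.ofAdd 1) (Multiplicative.ofAdd 1) rfl

/-- The length of an element: on positive elements, the number of letters of a positive word. -/
def length (g : DihedralArtin (2 * k + 1)) : ℤ := (lengthHom k g).toAdd

@[simp] theorem length_one : length (1 : DihedralArtin (2 * k + 1)) = 0 := by simp [length]

@[simp] theorem length_mul (g h : DihedralArtin (2 * k + 1)) :
    length (g * h) = length g + length h := by simp [length]

@[simp] theorem length_inv (g : DihedralArtin (2 * k + 1)) : length g⁻¹ = -length g := by
  simp [length]

@[simp] theorem length_pow (g : DihedralArtin (2 * k + 1)) (n : ℕ) :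
    length (g ^ n) = n * length g := by simp [length]

@[simp] theorem length_gen (e : Bool) : length (gen k e) = 1 := by
  cases e <;> simp [length, lengthHom]

@[simp] theorem length_t : length (t (2 * k + 1)) = 1 := length_gen false

@[simp] theorem length_Ω : length (Ω (2 * k + 1)) = 2 * k + 1 := by
  rw [length, Ω, map_altProd, lengthHom, lift_s, lift_t, altProd_self]
  simp

/-- In a group with `y ^ 2 = r ^ m`, both sides of the defining relation for `s = r⁻¹ y` and
`t = y r⁻¹` are `y` times a central power of `r`. -/
theorem altProd_of_amalgam {G' : Type*} [Group G'] {r y : G'} (h : y * y = r ^ (2 * k + 1 : ℤ)) :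
    altProd (r⁻¹ * y) (y * r⁻¹) (2 * k + 1) = y * r ^ ((2 * k + 1) * (k - 1) : ℤ) ∧
      altProd (y * r⁻¹) (r⁻¹ * y) (2 * k + 1) = y * r ^ ((2 * k + 1) * (k - 1) : ℤ) := by
  have hxy : r⁻¹ * y * (y * r⁻¹) = r ^ (2 * k - 1 : ℤ) := by
    rw [mul_assoc, ← mul_assoc y, h, ← zpow_neg_one, ← zpow_add, ← zpow_add]
    congr 1; ring
  have hc : Commute y (r ^ ((2 * k + 1) * (k - 1) : ℤ)) := by
    rw [zpow_mul, ← h]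
    exact ((Commute.refl y).mul_right (Commute.refl y)).zpow_right _
  constructor
  · rw [altProd_two_mul_add_one, altProd_two_mul, hxy, ← mul_assoc, hc.eq, mul_left_inj,
      ← zpow_natCast, ← zpow_mul, ← zpow_neg_one, ← zpow_add]
    congr 1; ring
  · rw [altProd, altProd_two_mul, hxy, mul_assoc, mul_right_inj,
      ← zpow_natCast, ← zpow_mul, ← zpow_neg_one, ← zpow_add]
    congr 1; ring

/-- The action of the group on the line, in which `st` and `Ω` act by rotations. -/
noncomputable def act (k : ℕ) : DihedralArtin (2 * k + 1) →* (Line k ≃o Line k) :=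
  lift ((Line.rot k)⁻¹ * Line.half k) (Line.half k * (Line.rot k)⁻¹)
    ((altProd_of_amalgam Line.half_mul_half).1.trans
      (altProd_of_amalgam Line.half_mul_half).2.symm)

theorem act_s (x : Line k) : act k (s _) x = Line.shift (-1) (Line.halfFun x) := by
  rw [act, lift_s]; rfl

theorem act_t (x : Line k) : act k (t _) x = Line.halfFun (Line.shift (-1) x) := by
  rw [act, lift_t]; rfl

theorem act_s_mul_t : act k (s _ * t _) = Line.rot k ^ (2 * k - 1 : ℤ) := by
  rw [map_mul, act, lift_s, lift_t, mul_assoc, ← mul_assoc (Line.half k), Line.half_mul_half,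
    ← zpow_neg_one, ← zpow_add, ← zpow_add]
  congr 1; ring

theorem act_Ω : act k (Ω _) = Line.half k * Line.rot k ^ ((2 * k + 1) * (k - 1) : ℤ) := by
  rw [Ω, map_altProd, act, lift_s, lift_t, (altProd_of_amalgam Line.half_mul_half).1]

theorem act_Δ : act k (Ω _ ^ 2) = Line.rot k ^ ((2 * k + 1) * (2 * k - 1) : ℤ) := by
  have hc : Commute (Line.half k) (Line.rot k ^ ((2 * k + 1) * (k - 1) : ℤ)) := by
    rw [zpow_mul, ← Line.half_mul_half]
    exact ((Commute.refl _).mul_right (Commute.refl _)).zpow_right _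
  rw [map_pow, act_Ω, hc.mul_pow, pow_two, Line.half_mul_half, ← zpow_natCast, ← zpow_mul,
    ← zpow_add]
  congr 1; push_cast; ring

theorem act_Δ_zpow_apply (j : ℤ) (x : Line k) :
    act k ((Ω _ ^ 2) ^ j) x = Line.shift ((2 * k + 1) * ((2 * k - 1) * j)) x := by
  rw [map_zpow, act_Δ, ← zpow_mul, Line.rot_zpow_apply, mul_assoc]

theorem act_shift (g : DihedralArtin (2 * k + 1)) (n : ℤ) (x : Line k) :
    act k g (Line.shift ((2 * k + 1) * n) x) = Line.shift ((2 * k + 1) * n) (act k g x) := by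
  have hle : Subgroup.closure (Set.range (gen k)) ≤
      (Subgroup.centralizer {Line.rot k ^ ((2 * k + 1) * n)}).comap (act k) := by
    rw [Subgroup.closure_le]
    have hr : Commute (Line.rot k)⁻¹ (Line.rot k ^ ((2 * k + 1) * n)) :=
      ((Commute.refl _).zpow_right _).inv_left
    have hh : Commute (Line.half k) (Line.rot k ^ ((2 * k + 1) * n)) := by
      rw [zpow_mul, ← Line.half_mul_half]
      exact ((Commute.refl _).mul_right (Commute.refl _)).zpow_right _
    rintro _ ⟨e, rfl⟩
    rw [SetLike.mem_coe, Subgroup.mem_comap, Subgroup.mem_centralizer_singleton_iff]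
    cases e
    · rw [gen_false, act, lift_t]; exact hh.mul_left hr
    · rw [gen_true, act, lift_s]; exact hr.mul_left hh
  have hg := hle (by rw [closure_gen]; trivial : g ∈ Subgroup.closure (Set.range (gen k)))
  rw [Subgroup.mem_comap, Subgroup.mem_centralizer_singleton_iff] at hg
  rw [← Line.rot_zpow_apply, ← Line.rot_zpow_apply, ← RelIso.mul_apply, hg, RelIso.mul_apply]

/-! ### Positive words -/

/-- The element that a positive word represents. -/
def ev (k : ℕ) (w : List Bool) : DihedralArtin (2 * k + 1) := (w.map (gen k)).prod

@[simp] theorem ev_nil : ev k [] = 1 := rfl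

@[simp] theorem ev_cons (e : Bool) (w : List Bool) : ev k (e :: w) = gen k e * ev k w := by
  simp [ev]

@[simp] theorem ev_append (v w : List Bool) : ev k (v ++ w) = ev k v * ev k w := by simp [ev]

@[simp] theorem length_ev (w : List Bool) : length (ev k w) = w.length := by
  induction w with
  | nil => simp
  | cons e w ih => simp [ih]; ring

theorem mem_M_iff {a : DihedralArtin (2 * k + 1)} :
    a ∈ (pair (2 * k + 1)).M ↔ ∃ w, ev k w = a := by
  constructor
  · intro h
    induction h using Submonoid.closure_induction with
    | mem x hx =>
      rcases hx with rfl | rfl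
      · exact ⟨[true], by simp⟩
      · exact ⟨[false], by simp⟩
    | one => exact ⟨[], rfl⟩
    | mul x y _ _ hx hy =>
      obtain ⟨v, rfl⟩ := hx
      obtain ⟨w, rfl⟩ := hy
      exact ⟨v ++ w, by simp⟩
  · rintro ⟨w, rfl⟩
    refine Submonoid.list_prod_mem _ fun x hx => Submonoid.subset_closure ?_
    obtain ⟨e, -, rfl⟩ := List.mem_map.1 hx
    cases e <;> simp

theorem ev_mem (w : List Bool) : ev k w ∈ (pair (2 * k + 1)).M := mem_M_iff.2 ⟨w, rfl⟩

/-- The length of the longest alternating prefix of a word. -/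
def run : List Bool → ℕ
  | [] => 0
  | e :: w => if w.head? = some !e then run w + 1 else 1

/-- A word is reduced if it has no alternating factor of length `m = 2 * k + 1`, so that it contains
neither of the two words for `Ω`. -/
def IsReduced (k : ℕ) : List Bool → Prop
  | [] => True
  | e :: w => run (e :: w) < 2 * k + 1 ∧ IsReduced k w

/-- The number of maximal blocks of letters `s` in a word. -/
def blocks : List Bool → ℕ
  | [] => 0
  | e :: w => blocks w + if e = true ∧ w.head? ≠ some true then 1 else 0

theorem run_pos {w : List Bool} (h : w ≠ []) : 1 ≤ run w := by
  cases w with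
  | nil => exact absurd rfl h
  | cons e w => rw [run]; split_ifs <;> omega

/-- Splits off an alternating prefix of a word. -/
theorem ev_eq_altProd_mul (n : ℕ) (e : Bool) (w : List Bool) (h : n ≤ run (e :: w)) :
    ev k (e :: w) = altProd (gen k e) (gen k !e) n * ev k ((e :: w).drop n) := by
  induction n generalizing e w with
  | zero => simp [altProd]
  | succ n ih =>
    rw [run] at h
    split_ifs at h with h'
    · obtain ⟨v, rfl⟩ : ∃ v, w = (!e) :: v := by
        cases w with
        | nil => simp at h'
        | cons a v => exact ⟨v, by simpa using h'⟩
      have h2 : altProd (gen k e) (gen k !e) (n + 1) =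
          gen k e * altProd (gen k !e) (gen k e) n := rfl
      have h3 := ih (!e) v (by omega)
      rw [Bool.not_not] at h3
      rw [ev_cons, h3, h2, List.drop_succ_cons, mul_assoc]
    · obtain rfl : n = 0 := by omega
      simp [altProd]

theorem exists_eq_mul_Ω_mul {w : List Bool} (h : ¬ IsReduced k w) :
    ∃ v v', ev k w = ev k v * Ω _ * ev k v' := by
  induction w with
  | nil => exact absurd trivial h
  | cons e w ih =>
    by_cases hw : IsReduced k w
    · have hr : 2 * k + 1 ≤ run (e :: w) := by
        by_contra hr
        exact h ⟨by omega, hw⟩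
      refine ⟨[], (e :: w).drop (2 * k + 1), (ev_eq_altProd_mul _ e w hr).trans ?_⟩
      rw [altProd_gen, ev_nil, one_mul]
    · obtain ⟨v, v', h'⟩ := ih hw
      exact ⟨e :: v, v', by rw [ev_cons, h', ev_cons]; simp only [mul_assoc]⟩

theorem run_le_append (w v : List Bool) : run w ≤ run (w ++ v) := by
  induction w with
  | nil => simp [run]
  | cons e w ih =>
    cases w with
    | nil => exact (show run [e] = 1 from rfl) ▸ run_pos (by simp)
    | cons a w =>
      have h₁ : run (e :: a :: w) = if a = !e then run (a :: w) + 1 else 1 := by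
        rw [run]; simp
      have h₂ : run (e :: a :: (w ++ v)) = if a = !e then run (a :: (w ++ v)) + 1 else 1 := by
        rw [run]; simp
      rw [List.cons_append, List.cons_append, h₁, h₂]
      rw [List.cons_append] at ih
      split_ifs <;> omega

theorem IsReduced.of_append {w v : List Bool} (h : IsReduced k (w ++ v)) :
    IsReduced k w ∧ IsReduced k v := by
  induction w with
  | nil => exact ⟨trivial, h⟩
  | cons e w ih =>
    exact ⟨⟨(run_le_append (e :: w) v).trans_lt h.1, (ih h.2).1⟩, (ih h.2).2⟩

theorem IsReduced.run_lt {w : List Bool} (h : IsReduced k w) : run w < 2 * k + 1 := by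
  cases w with
  | nil => simp [run]
  | cons e w => exact h.1

/-! ### The action of reduced words on the line -/

/-- The position of the image of a base point under a reduced word that starts with `e` and whose
longest alternating prefix has length `r`: in the arc with residue `m - r` modulo `m` if the first
letter is `s`, and in an arc with residue `0` and with first digit `m - r` if the first letter is
`t`. Here `N` is, up to a constant, the number of blocks of letters `s` in the word. -/
def Position (k : ℕ) (e : Bool) (r : ℕ) (N : ℤ) (x : Line k) : Prop :=
  if e then x.arc = (2 * k + 1) * (N - 1) + (2 * k + 1 - r)
  else x.arc = (2 * k + 1) * N ∧ (x.digits.head : ℕ) + r = 2 * k + 1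

theorem halfFun_eq_of_arc {x : Line k} {n : ℤ} (hx : x.arc = (2 * k + 1) * n)
    (h₀ : (x.digits.head : ℕ) ≠ 0) (h₁ : (x.digits.head : ℕ) ≠ 2 * k + 1) :
    (Line.halfFun x).arc = (2 * k + 1) * n + (x.digits.head : ℕ) ∧
      (Line.halfFun x).digits = x.digits.tail := by
  rw [Line.halfFun_mid x (by rw [hx]; exact Int.mul_emod_right _ _) h₀ h₁, ← hx]
  exact ⟨rfl, rfl⟩

theorem halfFun_eq_of_arc_add {x : Line k} {n : ℤ} {c : ℕ} (hx : x.arc = (2 * k + 1) * n + c)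
    (h₀ : 0 < c) (h₁ : c < 2 * k + 1) :
    (Line.halfFun x).arc = (2 * k + 1) * (n + 1) ∧
      ((Line.halfFun x).digits.head : ℕ) = c ∧ (Line.halfFun x).digits.tail = x.digits := by
  have h : x.arc % (2 * k + 1) = c := by
    rw [hx, Int.mul_add_emod_self_left]
    exact Int.emod_eq_of_lt (by omega) (by omega)
  obtain ⟨d, hd, e⟩ := Line.halfFun_out x (by omega)
  rw [e]
  refine ⟨?_, ?_, rfl⟩
  · rw [Line.arc_mk, h, hx]; ring
  · rw [h] at hd; simpa using hd

/-- A letter that prolongs the alternating prefix. -/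
theorem Position.of_ne {e : Bool} {r : ℕ} {N : ℤ} {x : Line k} (h : Position k (!e) r N x)
    (h₁ : 1 ≤ r) (h₂ : r + 1 < 2 * k + 1) :
    Position k e (r + 1) (N + if e then 1 else 0) (act k (gen k e) x) := by
  cases e
  · replace h : x.arc = (2 * k + 1) * (N - 1) + (2 * k + 1 - r) := h
    have := halfFun_eq_of_arc_add (x := Line.shift (-1) x) (n := N - 1) (c := 2 * k - r)
      (by rw [Line.arc_shift, h]; omega) (by omega) (by omega)
    rw [gen_false, act_t]
    refine ⟨?_, by omega⟩
    rw [this.1]; simp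
  · replace h : x.arc = (2 * k + 1) * N ∧ (x.digits.head : ℕ) + r = 2 * k + 1 := h
    have := halfFun_eq_of_arc h.1 (by omega) (by omega)
    rw [gen_true, act_s]
    show _ = _
    rw [Line.arc_shift, this.1, if_pos rfl]
    push_cast
    linarith [show ((x.digits.head : ℕ) : ℤ) + r = 2 * k + 1 by exact_mod_cast h.2]

/-- A letter that starts a new alternating prefix. -/
theorem Position.of_eq {e : Bool} {r : ℕ} {N : ℤ} {x : Line k} (h : Position k e r N x)
    (h₁ : 1 ≤ r) (h₂ : r < 2 * k + 1) : Position k e 1 N (act k (gen k e) x) := by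
  cases e
  · replace h : x.arc = (2 * k + 1) * N ∧ (x.digits.head : ℕ) + r = 2 * k + 1 := h
    have := halfFun_eq_of_arc_add (x := Line.shift (-1) x) (n := N - 1) (c := 2 * k)
      (by rw [Line.arc_shift, h.1]; push_cast; ring) (by omega) (by omega)
    rw [gen_false, act_t]
    refine ⟨?_, by omega⟩
    rw [this.1]; simp
  · replace h : x.arc = (2 * k + 1) * (N - 1) + (2 * k + 1 - r) := h
    have := halfFun_eq_of_arc_add (x := x) (n := N - 1) (c := 2 * k + 1 - r)
      (by omega) (by omega) (by omega)
    rw [gen_true, act_s]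
    show _ = _
    rw [Line.arc_shift, this.1]
    push_cast; ring

/-- The images of a base point under reduced words, if the last letter of the word moves the base
point to a regular position. -/
theorem position_ev {z : Line k} {c : ℤ} (e : Bool) (w : List Bool) (hw : IsReduced k (e :: w))
    (h : ∀ l, (e :: w).getLast? = some l →
      Position k l 1 (c + if l then 1 else 0) (act k (gen k l) z)) :
    Position k e (run (e :: w)) (c + blocks (e :: w)) (act k (ev k (e :: w)) z) := by
  induction w generalizing e with
  | nil =>
    have := h e rfl
    cases e <;> simpa [run, blocks] using this
  | cons a w ih =>
    have := ih a hw.2 (fun l hl => h l (by simpa using hl))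
    have h1 := run_pos (w := a :: w) (by simp)
    have h2 := hw.2.run_lt
    have h3 := hw.1
    rw [ev_cons, map_mul, RelIso.mul_apply]
    by_cases hae : a = !e
    · subst hae
      have hr : run (e :: (!e) :: w) = run ((!e) :: w) + 1 := by rw [run]; simp
      rw [hr] at h3 ⊢
      convert this.of_ne h1 h3 using 1
      rw [blocks]
      cases e <;> simp [add_assoc]
    · obtain rfl : a = e := by cases a <;> cases e <;> simp_all
      have hr : run (a :: a :: w) = 1 := by rw [run]; simp
      rw [hr]
      convert this.of_eq h1 h2 using 1
      rw [blocks]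
      cases a <;> simp

end DihedralArtin

/-! ### Uniqueness of reduced words -/

namespace DihedralArtin

variable {k : ℕ}

/-- The points of the line that the half-turn moves between the two exceptional digits. -/
def IsSpecial (x : Line k) : Prop :=
  x.arc % (2 * k + 1) = 0 ∧ ((x.digits.head : ℕ) = 0 ∨ (x.digits.head : ℕ) = 2 * k + 1)

theorem IsSpecial.act_Ω_pow {x : Line k} (h : IsSpecial x) (n : ℕ) :
    IsSpecial (act k (Ω _ ^ n) x) := by
  induction n with
  | zero => simpa using h
  | succ n ih =>
    rw [pow_succ', map_mul, RelIso.mul_apply]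
    generalize act k (Ω _ ^ n) x = y at ih
    rw [act_Ω, RelIso.mul_apply, Line.rot_zpow_apply, Line.half_apply]
    have hy : (Line.shift ((2 * k + 1) * (k - 1)) y).arc % (2 * k + 1) = 0 := by
      rw [Line.arc_shift, Int.add_mul_emod_self_left]; exact ih.1
    rcases ih.2 with h | h
    · rw [Line.halfFun_zero _ hy h]
      exact ⟨hy, Or.inr (by simp)⟩
    · rw [Line.halfFun_last _ hy h]
      refine ⟨?_, Or.inl (by simp)⟩
      rw [Line.arc_mk, Int.add_emod_right]
      exact hy

theorem IsSpecial.position_gen (hk : 1 ≤ k) {x : Line k} (h : IsSpecial x) (e : Bool) :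
    ∃ c : ℤ, Position k e 1 (c + if e then 1 else 0) (act k (gen k e) x) := by
  obtain ⟨q, hq⟩ := Int.dvd_of_emod_eq_zero h.1
  cases e
  · have := halfFun_eq_of_arc_add (x := Line.shift (-1) x) (n := q - 1) (c := 2 * k)
      (by rw [Line.arc_shift, hq]; push_cast; ring) (by omega) (by omega)
    refine ⟨q, ?_, ?_⟩
    · rw [gen_false, act_t, this.1]; simp
    · rw [gen_false, act_t, this.2.1]
  · rcases h.2 with h' | h'
    · refine ⟨q - 1, ?_⟩
      show _ = _
      rw [gen_true, act_s, Line.halfFun_zero _ h.1 h', Line.arc_shift, Line.arc_mk, hq, if_pos rfl]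
      push_cast; ring
    · refine ⟨q, ?_⟩
      show _ = _
      rw [gen_true, act_s, Line.halfFun_last _ h.1 h', Line.arc_shift, Line.arc_mk, hq, if_pos rfl]
      push_cast; ring

theorem IsSpecial.position_ev (hk : 1 ≤ k) {x : Line k} (h : IsSpecial x) {e : Bool}
    {w : List Bool} (hw : IsReduced k (e :: w)) :
    ∃ N, Position k e (run (e :: w)) N (act k (ev k (e :: w)) x) := by
  obtain ⟨l, hl⟩ : ∃ l, (e :: w).getLast? = some l := ⟨_, List.getLast?_eq_some_getLast (by simp)⟩
  obtain ⟨c, hc⟩ := h.position_gen hk l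
  refine ⟨_, DihedralArtin.position_ev (c := c) e w hw fun l' hl' => ?_⟩
  rw [hl, Option.some_inj] at hl'
  rw [← hl']; exact hc

theorem Position.arc_emod {e : Bool} {r : ℕ} {N : ℤ} {x : Line k} (h : Position k e r N x)
    (h₁ : 1 ≤ r) (h₂ : r < 2 * k + 1) :
    x.arc % (2 * k + 1) = if e then (2 * k + 1 - r : ℤ) else 0 := by
  cases e
  · rw [h.1]; simp
  · rw [show x.arc = _ from h, Int.mul_add_emod_self_left, if_pos rfl]
    exact Int.emod_eq_of_lt (by omega) (by omega)

theorem Position.not_isSpecial {e : Bool} {r : ℕ} {N : ℤ} {x : Line k} (h : Position k e r N x)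
    (h₁ : 1 ≤ r) (h₂ : r < 2 * k + 1) : ¬ IsSpecial x := by
  intro h'
  have h₃ := h.arc_emod h₁ h₂
  rw [h'.1] at h₃
  cases e
  · have := h'.2; have := h.2; omega
  · simp only [if_true] at h₃; omega

/-- Normal forms are unique: common first letters can be cancelled, and the position of the image of
a special point distinguishes words with different first letters from each other and, since `Ω`
preserves special points, from the empty word. -/
theorem eq_of_ev_mul_eq (hk : 1 ≤ k) {v w : List Bool} {n : ℕ} (hv : IsReduced k v)
    (hw : IsReduced k w) (h : ev k v * Ω _ ^ n = ev k w) : v = w ∧ n = 0 := by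
  have hb : IsSpecial (Line.mk 0 (toLex fun _ => 0) : Line k) := ⟨by simp, Or.inl rfl⟩
  induction v generalizing w with
  | nil =>
    cases w with
    | nil =>
      have := congrArg length h
      simp only [ev_nil, one_mul, length_pow, length_Ω, length_one] at this
      refine ⟨rfl, ?_⟩
      rcases mul_eq_zero.1 this with h | h <;> omega
    | cons e w =>
      obtain ⟨N, hN⟩ := hb.position_ev hk hw
      rw [← h, ev_nil, one_mul] at hN
      exact absurd (hb.act_Ω_pow n) (hN.not_isSpecial (run_pos (by simp)) hw.run_lt)
  | cons e v ih =>
    obtain ⟨N, hN⟩ := (hb.act_Ω_pow n).position_ev hk hv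
    rw [← RelIso.mul_apply, ← map_mul, h] at hN
    cases w with
    | nil =>
      rw [ev_nil, map_one] at hN
      exact absurd hb (hN.not_isSpecial (run_pos (by simp)) hv.run_lt)
    | cons e' w =>
      obtain ⟨N', hN'⟩ := hb.position_ev hk hw
      have h₁ := hN.arc_emod (run_pos (by simp)) hv.run_lt
      have h₂ := hN'.arc_emod (run_pos (by simp)) hw.run_lt
      have h₃ := hv.run_lt
      have h₄ := hw.run_lt
      have he : e = e' := by
        rw [h₁] at h₂
        cases e <;> cases e' <;> simp at h₂ ⊢ <;> omega
      subst he
      rw [ev_cons, ev_cons, mul_assoc, mul_right_inj] at h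
      obtain ⟨rfl, rfl⟩ := ih hv.2 hw.2 h
      exact ⟨rfl, rfl⟩

theorem Ω_mul_ev (w : List Bool) : Ω _ * ev k w = ev k (w.map not) * Ω _ := by
  induction w with
  | nil => simp
  | cons e w ih =>
    have := gen_mul_Ω (k := k) (!e)
    rw [Bool.not_not] at this
    rw [ev_cons, ← mul_assoc, ← this, mul_assoc, ih, List.map_cons, ev_cons, mul_assoc]

theorem exists_eq_mul_Ω {w : List Bool} (h : ¬ IsReduced k w) :
    ∃ v, ev k w = ev k v * Ω _ := by
  obtain ⟨v, v', h'⟩ := exists_eq_mul_Ω_mul h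
  exact ⟨v ++ v'.map not, by rw [h', mul_assoc, Ω_mul_ev, ← mul_assoc, ← ev_append]⟩

theorem exists_reduced_mul_Ω_pow (w : List Bool) :
    ∃ v n, IsReduced k v ∧ ev k w = ev k v * Ω _ ^ n := by
  by_cases h : IsReduced k w
  · exact ⟨w, 0, h, by simp⟩
  · obtain ⟨v, hv⟩ := exists_eq_mul_Ω h
    have hl : v.length < w.length := by
      have := congrArg length hv
      simp only [length_ev, length_mul, length_Ω] at this
      omega
    obtain ⟨v', n, h₁, h₂⟩ := exists_reduced_mul_Ω_pow v
    exact ⟨v', n + 1, h₁, by rw [hv, h₂, pow_succ, mul_assoc]⟩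
termination_by w.length

/-- A reduced word is the only positive word that represents its element. -/
theorem eq_of_ev_eq (hk : 1 ≤ k) {v w : List Bool} (hw : IsReduced k w)
    (h : ev k v = ev k w) : v = w := by
  by_cases hv : IsReduced k v
  · exact (eq_of_ev_mul_eq hk (n := 0) hv hw (by simpa using h)).1
  · obtain ⟨v₁, h₁⟩ := exists_eq_mul_Ω hv
    obtain ⟨v₂, n, h₂, h₃⟩ := exists_reduced_mul_Ω_pow (k := k) v₁
    have := (eq_of_ev_mul_eq hk (n := n + 1) h₂ hw
      (by rw [← h, h₁, h₃, pow_succ, mul_assoc])).2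
    omega

theorem isReduced_replicate (hk : 1 ≤ k) (n : ℕ) (e : Bool) :
    IsReduced k (List.replicate n e) := by
  induction n with
  | zero => trivial
  | succ n ih =>
    refine ⟨?_, ih⟩
    have : run (e :: List.replicate n e) = 1 := by
      cases n <;> simp [run, List.replicate_succ]
    omega

theorem ev_replicate (n : ℕ) (e : Bool) : ev k (List.replicate n e) = gen k e ^ n := by
  simp [ev]

/-- The factors of a power of a generator are powers of the same generator. -/
theorem eq_pow_of_mul_eq_pow (hk : 1 ≤ k) {a b : DihedralArtin (2 * k + 1)} {e : Bool} {n : ℕ}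
    (ha : a ∈ (pair (2 * k + 1)).M) (hb : b ∈ (pair (2 * k + 1)).M) (h : a * b = gen k e ^ n) :
    ∃ i j, a = gen k e ^ i ∧ b = gen k e ^ j ∧ i + j = n := by
  obtain ⟨v, rfl⟩ := mem_M_iff.1 ha
  obtain ⟨w, rfl⟩ := mem_M_iff.1 hb
  rw [← ev_append, ← ev_replicate] at h
  have h' := eq_of_ev_eq hk (isReduced_replicate hk n e) h
  rw [List.append_eq_replicate_iff] at h'
  exact ⟨v.length, w.length, by rw [← ev_replicate, ← h'.2.1], by rw [← ev_replicate, ← h'.2.2],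
    h'.1⟩

/-! ### The Garside structure -/

theorem gen_mem (e : Bool) : gen k e ∈ (pair (2 * k + 1)).M := by
  simpa using ev_mem (k := k) [e]

theorem altProd_mem {G : Type*} [Monoid G] {M : Submonoid G} {x y : G} (hx : x ∈ M) (hy : y ∈ M)
    (n : ℕ) : altProd x y n ∈ M := by
  induction n generalizing x y with
  | zero => exact M.one_mem
  | succ n ih => exact M.mul_mem hx (ih hy hx)

theorem Ω_mem : Ω _ ∈ (pair (2 * k + 1)).M := altProd_mem (gen_mem true) (gen_mem false) _

theorem Δ_pow_mem (n : ℕ) : (Ω _ ^ 2) ^ n ∈ (pair (2 * k + 1)).M :=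
  Submonoid.pow_mem _ (Submonoid.pow_mem _ Ω_mem _) _

theorem Ω_mul_inv_gen_mem (e : Bool) : Ω _ * (gen k e)⁻¹ ∈ (pair (2 * k + 1)).M := by
  have h := altProd_two_mul_add_one (gen k e) (gen k !e) k
  rw [altProd_gen] at h
  rw [h, mul_inv_cancel_right]
  exact altProd_mem (gen_mem _) (gen_mem _) _

theorem Δ_mul_inv_gen_mem (e : Bool) : Ω _ ^ 2 * (gen k e)⁻¹ ∈ (pair (2 * k + 1)).M := by
  rw [pow_two, mul_assoc]
  exact Submonoid.mul_mem _ Ω_mem (Ω_mul_inv_gen_mem e)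

theorem length_nonneg {a : DihedralArtin (2 * k + 1)} (ha : a ∈ (pair (2 * k + 1)).M) :
    0 ≤ length a := by
  obtain ⟨w, rfl⟩ := mem_M_iff.1 ha
  rw [length_ev]; positivity

theorem length_pos {a : DihedralArtin (2 * k + 1)} (ha : a ∈ (pair (2 * k + 1)).M) (h : a ≠ 1) :
    1 ≤ length a := by
  obtain ⟨w, rfl⟩ := mem_M_iff.1 ha
  rw [length_ev]
  cases w with
  | nil => exact absurd rfl h
  | cons e w => simp

theorem eq_one_or_exists_mul_inv_gen_mem {a : DihedralArtin (2 * k + 1)}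
    (ha : a ∈ (pair (2 * k + 1)).M) : a = 1 ∨ ∃ e, a * (gen k e)⁻¹ ∈ (pair (2 * k + 1)).M := by
  obtain ⟨w, rfl⟩ := mem_M_iff.1 ha
  rcases List.eq_nil_or_concat w with rfl | ⟨v, e, rfl⟩
  · exact Or.inl rfl
  · exact Or.inr ⟨e, by simpa using ev_mem v⟩

/-- If both generators divide a positive element on the right, then so does `Ω`. -/
theorem mul_inv_Ω_mem (hk : 1 ≤ k) {a : DihedralArtin (2 * k + 1)}
    (h : ∀ e, a * (gen k e)⁻¹ ∈ (pair (2 * k + 1)).M) : a * (Ω _)⁻¹ ∈ (pair (2 * k + 1)).M := by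
  have key : ∀ e, ∃ w, ev k (w ++ [e]) = a := fun e => by
    obtain ⟨w, hw⟩ := mem_M_iff.1 (h e)
    exact ⟨w, by simp [hw]⟩
  obtain ⟨v, hv⟩ := key true
  obtain ⟨w, hw⟩ := key false
  by_cases hr : IsReduced k (v ++ [true])
  · have := eq_of_ev_eq hk hr (hw.trans hv.symm)
    simpa using congrArg List.getLast? this
  · obtain ⟨u, hu⟩ := exists_eq_mul_Ω hr
    rw [← hv, hu, mul_inv_cancel_right]
    exact ev_mem u

section

variable {G : Type*} [Group G] {M : Submonoid G}

theorem leR_trans {a b c : G} (h : LeR M a b) (h' : LeR M b c) : LeR M a c := by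
  have := M.mul_mem h' h
  rwa [← mul_assoc, inv_mul_cancel_right] at this

theorem leR_mul_right {a b : G} (c : G) : LeR M (a * c) (b * c) ↔ LeR M a b := by
  rw [LeR, LeR, mul_inv_rev, mul_assoc, mul_inv_cancel_left]

theorem mem_of_leR {a b : G} (h : LeR M a b) (ha : a ∈ M) : b ∈ M := by
  have := M.mul_mem h ha
  rwa [inv_mul_cancel_right] at this

end

/-- Greatest common right divisors among the positive elements. If both generators divide `a` and `b`,
then so does `Ω`, so that the greatest common divisor with one given last letter is divisible by the
other generator as well. -/
theorem exists_gcd_of_mem (hk : 1 ≤ k) (n : ℕ) {a b : DihedralArtin (2 * k + 1)}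
    (ha : a ∈ (pair (2 * k + 1)).M) (hb : b ∈ (pair (2 * k + 1)).M) (hn : length a + length b ≤ n) :
    ∃ g ∈ (pair (2 * k + 1)).M, LeR (pair (2 * k + 1)).M g a ∧ LeR (pair (2 * k + 1)).M g b ∧
      ∀ d ∈ (pair (2 * k + 1)).M, LeR (pair (2 * k + 1)).M d a → LeR (pair (2 * k + 1)).M d b →
        LeR (pair (2 * k + 1)).M d g := by
  induction n using Nat.strong_induction_on generalizing a b with
  | _ n ih =>
  set M := (pair (2 * k + 1)).M with hM
  -- a common divisor that is the greatest among those with a given last letter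
  have key : ∀ e, LeR M (gen k e) a → LeR M (gen k e) b → ∃ g ∈ M, LeR M g a ∧ LeR M g b ∧
      ∀ d ∈ M, LeR M (gen k e) d → LeR M d a → LeR M d b → LeR M d g := by
    intro e hea heb
    have h₁ := length_nonneg hea
    have h₂ := length_nonneg heb
    simp only [length_mul, length_inv, length_gen] at h₁ h₂
    obtain ⟨g, hg, hga, hgb, hg'⟩ := ih (n - 1) (by omega) hea heb
      (by simp only [length_mul, length_inv, length_gen]; omega)
    have hc : ∀ c : DihedralArtin (2 * k + 1), c = c * (gen k e)⁻¹ * gen k e := by simp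
    refine ⟨g * gen k e, M.mul_mem hg (gen_mem e), ?_, ?_, fun d _ hed hda hdb => ?_⟩
    · rw [hc a, leR_mul_right]; exact hga
    · rw [hc b, leR_mul_right]; exact hgb
    · rw [hc d, leR_mul_right]
      refine hg' _ hed ?_ ?_
      · rwa [leR_mul_right]
      · rwa [leR_mul_right]
  by_cases hs : ∃ e, LeR M (gen k e) a ∧ LeR M (gen k e) b
  · obtain ⟨e, hea, heb⟩ := hs
    obtain ⟨g, hg, hga, hgb, hg'⟩ := key e hea heb
    by_cases ht : LeR M (gen k !e) a ∧ LeR M (gen k !e) b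
    · obtain ⟨h, hh, hha, hhb, hh'⟩ := key (!e) ht.1 ht.2
      have hΩ : ∀ c, LeR M (gen k e) c → LeR M (gen k !e) c → LeR M (Ω _) c := fun c h₁ h₂ =>
        mul_inv_Ω_mem hk fun e' => by
          by_cases he : e' = e
          · rw [he]; exact h₁
          · rw [show e' = !e by cases e <;> cases e' <;> simp_all]; exact h₂
      have hΩg : LeR M (Ω _) g :=
        hg' _ Ω_mem (Ω_mul_inv_gen_mem e) (hΩ a hea ht.1) (hΩ b heb ht.2)
      have hgh : LeR M g h := hh' g hg (leR_trans (Ω_mul_inv_gen_mem (!e)) hΩg) hga hgb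
      refine ⟨h, hh, hha, hhb, fun d hd hda hdb => ?_⟩
      rcases eq_one_or_exists_mul_inv_gen_mem hd with rfl | ⟨e', he'⟩
      · simpa [LeR] using hh
      · by_cases he : e' = e
        · subst he
          exact leR_trans (hg' d hd he' hda hdb) hgh
        · rw [show e' = !e by cases e <;> cases e' <;> simp_all] at he'
          exact hh' d hd he' hda hdb
    · refine ⟨g, hg, hga, hgb, fun d hd hda hdb => ?_⟩
      rcases eq_one_or_exists_mul_inv_gen_mem hd with rfl | ⟨e', he'⟩
      · simpa [LeR] using hg
      · by_cases he : e' = e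
        · subst he
          exact hg' d hd he' hda hdb
        · rw [show e' = !e by cases e <;> cases e' <;> simp_all] at he'
          exact absurd ⟨leR_trans he' hda, leR_trans he' hdb⟩ ht
  · refine ⟨1, M.one_mem, by simpa [LeR] using ha, by simpa [LeR] using hb,
      fun d hd hda hdb => ?_⟩
    rcases eq_one_or_exists_mul_inv_gen_mem hd with rfl | ⟨e', he'⟩
    · simp [LeR, M.one_mem]
    · exact absurd ⟨e', leR_trans he' hda, leR_trans he' hdb⟩ hs

/-- Every element is a positive one up to a power of the central element `Δ`. -/
theorem exists_mul_Δ_pow_mem (g : DihedralArtin (2 * k + 1)) :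
    ∃ n : ℕ, g * (Ω _ ^ 2) ^ n ∈ (pair (2 * k + 1)).M := by
  have hg : g ∈ Subgroup.closure (Set.range (gen k)) := by rw [closure_gen]; trivial
  induction hg using Subgroup.closure_induction_left with
  | one => exact ⟨0, by simp⟩
  | mul_left x hx y _ ih =>
    obtain ⟨e, rfl⟩ := hx
    obtain ⟨n, hn⟩ := ih
    exact ⟨n, by rw [mul_assoc]; exact Submonoid.mul_mem _ (gen_mem e) hn⟩
  | inv_mul_cancel x hx y _ ih =>
    obtain ⟨e, rfl⟩ := hx
    obtain ⟨n, hn⟩ := ih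
    refine ⟨n + 1, ?_⟩
    rw [pow_succ, ← mul_assoc, ← Δ_mul_comm, ← mul_assoc, ← mul_assoc, mul_assoc _ y]
    exact Submonoid.mul_mem _ (Δ_mul_inv_gen_mem e) hn

theorem mul_Δ_pow_mem_of_le {g : DihedralArtin (2 * k + 1)} {n n' : ℕ} (h : n ≤ n')
    (hn : g * (Ω _ ^ 2) ^ n ∈ (pair (2 * k + 1)).M) :
    g * (Ω _ ^ 2) ^ n' ∈ (pair (2 * k + 1)).M := by
  obtain ⟨i, rfl⟩ := Nat.exists_eq_add_of_le h
  rw [pow_add, ← mul_assoc]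
  exact Submonoid.mul_mem _ hn (Δ_pow_mem i)

theorem exists_inf (hk : 1 ≤ k) (α β : DihedralArtin (2 * k + 1)) :
    ∃ γ, LeR (pair (2 * k + 1)).M γ α ∧ LeR (pair (2 * k + 1)).M γ β ∧
      ∀ δ, LeR (pair (2 * k + 1)).M δ α → LeR (pair (2 * k + 1)).M δ β →
        LeR (pair (2 * k + 1)).M δ γ := by
  set M := (pair (2 * k + 1)).M with hM
  have gcd : ∀ a ∈ M, ∀ b ∈ M, ∃ g ∈ M, LeR M g a ∧ LeR M g b ∧
      ∀ d ∈ M, LeR M d a → LeR M d b → LeR M d g := fun a ha b hb =>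
    exists_gcd_of_mem hk (length a + length b).toNat ha hb (Int.self_le_toNat _)
  obtain ⟨n₁, h₁⟩ := exists_mul_Δ_pow_mem α
  obtain ⟨n₂, h₂⟩ := exists_mul_Δ_pow_mem β
  have ha := mul_Δ_pow_mem_of_le (Nat.le_add_right n₁ n₂) h₁
  have hb := mul_Δ_pow_mem_of_le (Nat.le_add_left n₂ n₁) h₂
  set D := (Ω (2 * k + 1) ^ 2) ^ (n₁ + n₂)
  obtain ⟨g, hg, hga, hgb, hg'⟩ := gcd _ ha _ hb
  have hc : ∀ c x : DihedralArtin (2 * k + 1), LeR M (c * x⁻¹) α ↔ LeR M c (α * x) :=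
    fun c x => by rw [← leR_mul_right x, inv_mul_cancel_right]
  refine ⟨g * D⁻¹, ?_, ?_, fun δ hα hβ => ?_⟩
  · rw [← leR_mul_right D, inv_mul_cancel_right]; exact hga
  · rw [← leR_mul_right D, inv_mul_cancel_right]; exact hgb
  · -- a power `E` of `Δ` moves the common divisor `δ` into the monoid; greatest common divisors are
    -- compatible with the multiplication by `E`
    obtain ⟨n, hn⟩ := exists_mul_Δ_pow_mem (δ * D)
    have hE := Δ_pow_mem (k := k) n
    set E := (Ω (2 * k + 1) ^ 2) ^ n
    obtain ⟨h, hh, hha, hhb, hh'⟩ := gcd (α * D * E) (M.mul_mem ha hE) (β * D * E) (M.mul_mem hb hE)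
    have e₁ : LeR M (g * E) h :=
      hh' _ (M.mul_mem hg hE) ((leR_mul_right E).2 hga) ((leR_mul_right E).2 hgb)
    have hhE : h = h * E⁻¹ * E := by simp
    rw [hhE, leR_mul_right] at e₁ hha hhb
    have e₂ := hg' _ (mem_of_leR e₁ hg) hha hhb
    have e₃ := hh' _ hn ((leR_mul_right E).2 ((leR_mul_right D).2 hα))
      ((leR_mul_right E).2 ((leR_mul_right D).2 hβ))
    rw [hhE, leR_mul_right] at e₃
    rw [← leR_mul_right D, inv_mul_cancel_right]
    exact leR_trans e₃ e₂

theorem exists_sup (hk : 1 ≤ k) (α β : DihedralArtin (2 * k + 1)) :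
    ∃ γ, LeR (pair (2 * k + 1)).M α γ ∧ LeR (pair (2 * k + 1)).M β γ ∧
      ∀ δ, LeR (pair (2 * k + 1)).M α δ → LeR (pair (2 * k + 1)).M β δ →
        LeR (pair (2 * k + 1)).M γ δ := by
  set M := (pair (2 * k + 1)).M with hM
  let U : Set (DihedralArtin (2 * k + 1)) := {γ | LeR M α γ ∧ LeR M β γ}
  have hU : U.Nonempty := by
    obtain ⟨n₁, h₁⟩ := exists_mul_Δ_pow_mem α⁻¹
    obtain ⟨n₂, h₂⟩ := exists_mul_Δ_pow_mem β⁻¹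
    have hD : ∀ g : DihedralArtin (2 * k + 1), (Ω (2 * k + 1) ^ 2) ^ (n₁ + n₂) * g =
        g * (Ω (2 * k + 1) ^ 2) ^ (n₁ + n₂) := fun g => (Commute.pow_left (Δ_mul_comm g) _).eq
    refine ⟨(Ω _ ^ 2) ^ (n₁ + n₂), ?_, ?_⟩
    · rw [LeR, hD]; exact mul_Δ_pow_mem_of_le (Nat.le_add_right n₁ n₂) h₁
    · rw [LeR, hD]; exact mul_Δ_pow_mem_of_le (Nat.le_add_left n₂ n₁) h₂
  -- an upper bound of minimal length is the least one, since upper bounds are closed under `inf`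
  obtain ⟨γ, hγ, hmin⟩ := WellFounded.has_min
    (measure fun g : DihedralArtin (2 * k + 1) => (length g - length α).toNat).wf U hU
  refine ⟨γ, hγ.1, hγ.2, fun δ hα hβ => ?_⟩
  obtain ⟨ι, h₁, h₂, h₃⟩ := exists_inf hk γ δ
  have hι : ι ∈ U := ⟨h₃ α hγ.1 hα, h₃ β hγ.2 hβ⟩
  have hle : ¬ (length ι - length α).toNat < (length γ - length α).toNat := hmin ι hι
  have l₁ := length_nonneg hι.1
  have l₂ := length_nonneg h₁
  simp only [length_mul, length_inv] at l₁ l₂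
  have : γ * ι⁻¹ = 1 := by
    by_contra hne
    have := length_pos h₁ hne
    simp only [length_mul, length_inv] at this
    omega
  rw [mul_inv_eq_one] at this
  rw [this]; exact h₂

theorem eq_one_of_mem_of_inv_mem {a : DihedralArtin (2 * k + 1)} (ha : a ∈ (pair (2 * k + 1)).M)
    (ha' : a⁻¹ ∈ (pair (2 * k + 1)).M) : a = 1 := by
  by_contra h
  have h₁ := length_pos ha h
  have h₂ := length_nonneg ha'
  rw [length_inv] at h₂
  omega

theorem isGarsideStructure (hk : 1 ≤ k) :
    IsGarsideStructure (pair (2 * k + 1)).M (pair (2 * k + 1)).Δ where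
  eq_one_of_mem_of_inv_mem _ := eq_one_of_mem_of_inv_mem
  balanced := by
    refine ⟨Submonoid.pow_mem _ Ω_mem _, Set.ext fun b => and_congr_right fun _ => ?_⟩
    show Ω _ ^ 2 * b⁻¹ ∈ _ ↔ b⁻¹ * Ω _ ^ 2 ∈ _
    rw [Δ_mul_comm]
  noetherian a _ := by
    refine ⟨(length a).toNat + 1, by omega, fun l hl hla => ?_⟩
    have : (l.length : ℤ) ≤ length l.prod := by
      clear hla
      induction l with
      | nil => simp
      | cons x l ih =>
        have h₁ := ih fun y hy => hl y (List.mem_cons_of_mem _ hy)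
        have h₂ := length_pos (hl x List.mem_cons_self).1 (hl x List.mem_cons_self).2
        rw [List.prod_cons, length_mul, List.length_cons]
        push_cast
        omega
    rw [hla] at this
    omega
  finite_div := by
    refine ((List.finite_length_le Bool (2 * (2 * k + 1))).image (ev k)).subset ?_
    rintro b ⟨hb, hb'⟩
    obtain ⟨w, rfl⟩ := mem_M_iff.1 hb
    refine ⟨w, ?_, rfl⟩
    have := length_nonneg hb'
    change 0 ≤ length (Ω _ ^ 2 * (ev k w)⁻¹) at this
    simp only [length_mul, length_inv, length_pow, length_Ω, length_ev] at this
    show w.length ≤ _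
    push_cast at this
    omega
  monoid_closure_div := by
    refine le_antisymm (Submonoid.closure_le.2 fun b hb => hb.1) (Submonoid.closure_le.2 ?_)
    rintro _ (rfl | rfl)
    · exact Submonoid.subset_closure ⟨gen_mem true, Δ_mul_inv_gen_mem true⟩
    · exact Submonoid.subset_closure ⟨gen_mem false, Δ_mul_inv_gen_mem false⟩
  group_closure_div := by
    rw [eq_top_iff, ← closure_gen, Subgroup.closure_le]
    rintro _ ⟨e, rfl⟩
    exact Subgroup.subset_closure ⟨gen_mem e, Δ_mul_inv_gen_mem e⟩
  exists_inf := exists_inf hk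
  exists_sup := exists_sup hk

end DihedralArtin

/-! ### Alternating forms -/

section

variable {G : Type*} [Group G] {M N₁ N₂ : Submonoid G}

theorem IsTail.eq (hM : ∀ a ∈ M, a⁻¹ ∈ M → a = 1) {a b b' : G} (h : IsTail M N₁ a b)
    (h' : IsTail M N₁ a b') : b = b' := by
  have hs := h.2.symm.trans h'.2
  have h₁ : b ∈ {c | c ∈ N₁ ∧ LeR M c b'} := hs ▸ ⟨h.1, by simp [LeR, M.one_mem]⟩
  have h₂ : b' ∈ {c | c ∈ N₁ ∧ LeR M c b} := hs.symm ▸ ⟨h'.1, by simp [LeR, M.one_mem]⟩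
  have := hM _ h₁.2 (by rw [mul_inv_rev, inv_inv]; exact h₂.2)
  exact (mul_inv_eq_one.1 this).symm

theorem IsAlternatingForm.singleton {b : G} (h : IsTail M N₁ b b) (hb : b ≠ 1) :
    IsAlternatingForm M N₂ N₁ b [b] where
  ne_nil := by simp
  last_ne_one := hb
  prod_eq := by simp
  odd_tail i hi _ := by
    obtain rfl : i = 0 := by simpa using hi
    simpa using h
  even_tail i hi h2 := by
    obtain rfl : i = 0 := by simpa using hi
    exact absurd h2 (by decide)

theorem IsAlternatingForm.cons {a b : G} {l : List G} (h : IsAlternatingForm M N₁ N₂ a l)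
    (hb : IsTail M N₁ (a * b) b) : IsAlternatingForm M N₂ N₁ (a * b) (b :: l) where
  ne_nil := by simp
  last_ne_one := by rw [List.getLast_cons h.ne_nil]; exact h.last_ne_one
  prod_eq := by simp [h.prod_eq]
  odd_tail i hi h1 := by
    cases i with
    | zero => simpa [h.prod_eq] using hb
    | succ i => exact h.even_tail i (by simpa using hi) (by
        rw [Nat.odd_add_one, Nat.not_odd_iff_even] at h1; exact h1)
  even_tail i hi h1 := by
    cases i with
    | zero => exact absurd h1 (by decide)
    | succ i => exact h.odd_tail i (by simpa using hi) (by
        rw [Nat.even_add_one, Nat.not_even_iff_odd] at h1; exact h1)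

theorem IsAlternatingForm.head_tail {a b : G} {l : List G}
    (h : IsAlternatingForm M N₂ N₁ a (b :: l)) : IsTail M N₁ a b := by
  have := h.odd_tail 0 (by simp) (by decide)
  rwa [List.drop_zero, h.prod_eq] at this

theorem IsAlternatingForm.of_cons {a b : G} {l : List G}
    (h : IsAlternatingForm M N₂ N₁ a (b :: l)) (hl : l ≠ []) :
    IsAlternatingForm M N₁ N₂ (a * b⁻¹) l where
  ne_nil := hl
  last_ne_one := by rw [← List.getLast_cons (a := b) hl]; exact h.last_ne_one
  prod_eq := by rw [← h.prod_eq]; simp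
  odd_tail i hi h1 := h.even_tail (i + 1) (by simpa using hi) h1.add_one
  even_tail i hi h1 := h.odd_tail (i + 1) (by simpa using hi) h1.add_one

theorem not_isAlternatingForm_one (hM : ∀ a ∈ M, a⁻¹ ∈ M → a = 1) (h₁ : N₁ ≤ M) (h₂ : N₂ ≤ M)
    (l : List G) : ¬ IsAlternatingForm M N₂ N₁ 1 l := by
  induction l generalizing N₁ N₂ with
  | nil => exact fun h => h.ne_nil rfl
  | cons b l ih =>
    intro h
    have hb := h.head_tail
    have hb' : b ∈ {c | c ∈ N₁ ∧ LeR M c 1} := hb.2.symm ▸ ⟨hb.1, by simp [LeR, M.one_mem]⟩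
    obtain rfl : b = 1 := hM b (h₁ hb.1) (by simpa [LeR] using hb'.2)
    by_cases hl : l = []
    · subst hl; exact h.last_ne_one rfl
    · have := h.of_cons hl
      rw [inv_one, mul_one] at this
      exact ih h₂ h₁ this

/-- The length of an alternating form is determined by the element, so that the infimum in the
definition of the breadth is attained by any alternating form. -/
theorem IsAlternatingForm.length_eq (hM : ∀ a ∈ M, a⁻¹ ∈ M → a = 1) (h₁ : N₁ ≤ M) (h₂ : N₂ ≤ M)
    {a : G} {l l' : List G} (h : IsAlternatingForm M N₂ N₁ a l)
    (h' : IsAlternatingForm M N₂ N₁ a l') : l.length = l'.length := by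
  induction l generalizing N₁ N₂ a l' with
  | nil => exact absurd rfl h.ne_nil
  | cons b l ih =>
    cases l' with
    | nil => exact absurd rfl h'.ne_nil
    | cons b' l' =>
      obtain rfl := h.head_tail.eq hM h'.head_tail
      by_cases hl : l = [] <;> by_cases hl' : l' = []
      · rw [hl, hl']
      · have hab : a = b := by rw [← h.prod_eq, hl]; simp
        have := h'.of_cons hl'
        rw [hab, mul_inv_cancel] at this
        exact absurd this (not_isAlternatingForm_one hM h₂ h₁ _)
      · have hab : a = b := by rw [← h'.prod_eq, hl']; simp
        have := h.of_cons hl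
        rw [hab, mul_inv_cancel] at this
        exact absurd this (not_isAlternatingForm_one hM h₂ h₁ _)
      · rw [List.length_cons, List.length_cons, ih h₂ h₁ (h.of_cons hl) (h'.of_cons hl')]

theorem IsAlternatingForm.depth_eq (hM : ∀ a ∈ M, a⁻¹ ∈ M → a = 1) (h₁ : N₁ ≤ M) (h₂ : N₂ ≤ M)
    {a : G} {l : List G} (h : IsAlternatingForm M N₂ N₁ a l) :
    depth M N₂ N₁ a = l.length / 2 := by
  have hb : breadth M N₂ N₁ a = l.length := by
    rw [breadth, if_neg]
    · have : {p | ∃ l : List G, IsAlternatingForm M N₂ N₁ a l ∧ l.length = p} = {l.length} := by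
        ext p
        constructor
        · rintro ⟨l', hl', rfl⟩
          exact hl'.length_eq hM h₁ h₂ h
        · rintro rfl
          exact ⟨l, h, rfl⟩
      rw [this, csInf_singleton]
    · rintro rfl
      exact not_isAlternatingForm_one hM h₁ h₂ l h
  rw [depth, hb]
  split_ifs with ho
  · obtain ⟨n, hn⟩ := ho
    omega
  · rfl

theorem depth_one : depth M N₂ N₁ (1 : G) = 0 := by
  simp [depth, breadth]

end

namespace DihedralArtin

variable {k : ℕ}

/-! ### The depth counts the blocks of letters `s` -/

theorem powers_gen_le (e : Bool) : Submonoid.powers (gen k e) ≤ (pair (2 * k + 1)).M := by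
  rw [Submonoid.powers_le]; exact gen_mem e

theorem isTail_gen_pow (hk : 1 ≤ k) {v : List Bool} {e : Bool} (hv : IsReduced k v)
    (he : v.getLast? ≠ some e) (n : ℕ) :
    IsTail (pair (2 * k + 1)).M (Submonoid.powers (gen k e)) (ev k v * gen k e ^ n)
      (gen k e ^ n) := by
  refine ⟨⟨n, rfl⟩, Set.ext fun c => and_congr_right ?_⟩
  rintro ⟨j, rfl⟩
  show LeR _ (gen k e ^ j) _ ↔ LeR _ (gen k e ^ j) _
  by_cases hj : j ≤ n
  · obtain ⟨i, rfl⟩ := Nat.exists_eq_add_of_le' hj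
    have : gen k e ^ i ∈ (pair (2 * k + 1)).M := Submonoid.pow_mem _ (gen_mem e) i
    rw [LeR, LeR, pow_add, ← mul_assoc, mul_inv_cancel_right, mul_inv_cancel_right]
    exact ⟨fun _ => this, fun _ => Submonoid.mul_mem _ (ev_mem v) this⟩
  · constructor
    · intro h
      exfalso
      obtain ⟨i, hi, rfl⟩ : ∃ i, 1 ≤ i ∧ j = i + n := ⟨j - n, by omega, by omega⟩
      rw [pow_add, leR_mul_right] at h
      obtain ⟨w, hw⟩ := mem_M_iff.1 h
      have h' : ev k (w ++ List.replicate i e) = ev k v := by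
        rw [ev_append, ev_replicate, hw, inv_mul_cancel_right]
      rw [← eq_of_ev_eq hk hv h', List.getLast?_append, List.getLast?_replicate,
        if_neg (by omega)] at he
      exact he rfl
    · intro h
      have := length_nonneg h
      simp only [length_mul, length_inv, length_pow, length_gen] at this
      omega

theorem exists_eq_append_replicate (w : List Bool) (e : Bool) :
    ∃ v n, w = v ++ List.replicate n e ∧ v.getLast? ≠ some e := by
  induction w using List.reverseRecOn with
  | nil => exact ⟨[], 0, rfl, by simp⟩
  | append_singleton w a ih =>
    by_cases h : a = e
    · obtain ⟨v, n, rfl, hv⟩ := ih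
      exact ⟨v, n + 1, by rw [h, List.append_assoc, ← List.replicate_succ'], hv⟩
    · exact ⟨w ++ [a], 0, by simp, by simpa using h⟩

theorem blocks_replicate (n : ℕ) (e : Bool) :
    blocks (List.replicate (n + 1) e) = if e then 1 else 0 := by
  induction n with
  | zero => cases e <;> rfl
  | succ n ih =>
    rw [List.replicate_succ, blocks, ih]
    cases e <;> simp [List.replicate_succ]

theorem blocks_append_replicate {v : List Bool} {e : Bool} (h : v.getLast? ≠ some e) (n : ℕ) :
    blocks (v ++ List.replicate (n + 1) e) = blocks v + if e then 1 else 0 := by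
  induction v with
  | nil => simp [blocks_replicate, blocks]
  | cons a v ih =>
    cases v with
    | nil =>
      rw [List.cons_append, blocks, List.nil_append, blocks_replicate]
      cases a <;> cases e <;> simp [List.replicate_succ, blocks] at h ⊢
    | cons b v =>
      rw [List.cons_append, blocks, ih (by simpa using h)]
      simp [blocks]
      omega

/-- The maximal powers of letters in a reduced word are the factors of an alternating form. -/
theorem exists_isAlternatingForm_ev (hk : 1 ≤ k) (w : List Bool) (hw : IsReduced k w) (e : Bool)
    (he : w.getLast? = some e) :
    ∃ l, IsAlternatingForm (pair (2 * k + 1)).M (Submonoid.powers (gen k !e))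
      (Submonoid.powers (gen k e)) (ev k w) l ∧
      blocks w = if e then (l.length + 1) / 2 else l.length / 2 := by
  obtain ⟨v, n, rfl, hv⟩ := exists_eq_append_replicate w e
  have hv' := hw.of_append.1
  obtain ⟨n, rfl⟩ : ∃ i, n = i + 1 := by
    cases n with
    | zero => exact absurd (by simpa using he) hv
    | succ n => exact ⟨n, rfl⟩
  have ht := isTail_gen_pow hk hv' hv (n + 1)
  rw [ev_append, ev_replicate, blocks_append_replicate hv]
  cases hl : v.getLast? with
  | none =>
    rw [List.getLast?_eq_none_iff] at hl
    subst hl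
    rw [ev_nil, one_mul] at ht ⊢
    refine ⟨_, .singleton ht fun h => ?_, by cases e <;> simp [blocks]⟩
    have := congrArg length h
    simp only [length_pow, length_gen, length_one] at this
    omega
  | some e' =>
    rw [hl, ne_eq, Option.some_inj] at hv
    obtain rfl : e' = !e := by cases e <;> cases e' <;> simp_all
    obtain ⟨l, h₁, h₂⟩ := exists_isAlternatingForm_ev hk v hv' _ hl
    rw [Bool.not_not] at h₁
    refine ⟨_, h₁.cons ht, ?_⟩
    rw [h₂]
    cases e <;> simp; omega
termination_by w.length
decreasing_by grind

/-- Every positive element is the product of a reduced word that does not end in `t`, and its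
tail in the submonoid generated by `t`. -/
theorem exists_eq_ev_mul_t_pow (a : DihedralArtin (2 * k + 1)) (ha : a ∈ (pair (2 * k + 1)).M) :
    ∃ u n, IsReduced k u ∧ u.getLast? ≠ some false ∧ a = ev k u * t _ ^ n := by
  by_cases h : a * (gen k false)⁻¹ ∈ (pair (2 * k + 1)).M
  · have hl := length_nonneg h
    obtain ⟨u, n, h₁, h₂, h₃⟩ := exists_eq_ev_mul_t_pow _ h
    refine ⟨u, n + 1, h₁, h₂, ?_⟩
    rw [pow_succ, ← mul_assoc, ← h₃, ← gen_false, inv_mul_cancel_right]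
  · obtain ⟨w, rfl⟩ := mem_M_iff.1 ha
    refine ⟨w, 0, ?_, ?_, by simp⟩
    · by_contra hw
      obtain ⟨v, hv⟩ := exists_eq_mul_Ω hw
      rw [hv, mul_assoc] at h
      exact h (Submonoid.mul_mem _ (ev_mem v) (Ω_mul_inv_gen_mem false))
    · intro hw
      obtain ⟨v, rfl⟩ := List.getLast?_eq_some_iff.1 hw
      rw [ev_append] at h
      simp only [ev_cons, ev_nil, mul_one, mul_inv_cancel_right] at h
      exact h (ev_mem v)
termination_by (length a).toNat
decreasing_by
  simp only [length_mul, length_inv, length_gen] at hl ⊢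
  omega

theorem dpt_ev_mul_t_pow (hk : 1 ≤ k) {u : List Bool} (n : ℕ) (hu : IsReduced k u)
    (hl : u.getLast? ≠ some false) : (pair (2 * k + 1)).dpt (ev k u * t _ ^ n) = blocks u := by
  have hM : ∀ a ∈ (pair (2 * k + 1)).M, a⁻¹ ∈ (pair (2 * k + 1)).M → a = 1 :=
    fun _ => eq_one_of_mem_of_inv_mem
  have ht := isTail_gen_pow hk hu hl n
  cases h : u.getLast? with
  | none =>
    rw [List.getLast?_eq_none_iff] at h
    subst h
    rw [ev_nil, one_mul] at ht ⊢
    by_cases hn : t (2 * k + 1) ^ n = 1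
    · rw [hn]; exact depth_one
    · exact ((IsAlternatingForm.singleton ht hn).depth_eq hM (powers_gen_le _)
        (powers_gen_le true)).trans (by simp [blocks])
  | some e =>
    obtain rfl : e = true := by cases e <;> simp_all
    obtain ⟨l, h₁, h₂⟩ := exists_isAlternatingForm_ev hk u hu true h
    rw [h₂]
    exact (h₁.cons ht).depth_eq hM (powers_gen_le false) (powers_gen_le true)

/-! ### The orbit of the fixed point of `t` -/

/-- The point with arc number `1` and all digits `1`. It is fixed by `t`. -/
def base (k : ℕ) : Line k := Line.mk 1 (toLex fun _ => 1)

theorem head_base : ((base k).digits.head : ℕ) = 1 := by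
  show ((1 : Fin (2 * k + 2)) : ℕ) = 1
  simp

theorem act_t_base (hk : 1 ≤ k) : act k (t _) (base k) = base k := by
  have h₁ : ((Line.shift (-1) (base k)).digits.head : ℕ) = 1 := head_base
  have := halfFun_eq_of_arc (x := Line.shift (-1) (base k)) (n := 0) rfl (by omega) (by omega)
  rw [act_t]
  refine Line.ext ?_ this.2
  rw [this.1, h₁, mul_zero]; rfl

theorem act_t_zpow_base (hk : 1 ≤ k) (n : ℤ) : act k (t _ ^ n) (base k) = base k := by
  have h : t (2 * k + 1) ∈ (MulAction.stabilizer (Line k ≃o Line k) (base k)).comap (act k) :=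
    act_t_base hk
  exact Subgroup.zpow_mem _ h n

theorem act_t_pow_base (hk : 1 ≤ k) (n : ℕ) : act k (t _ ^ n) (base k) = base k := by
  rw [← zpow_natCast]; exact act_t_zpow_base hk n

theorem position_base (hk : 1 ≤ k) {e : Bool} {w : List Bool} (hw : IsReduced k (e :: w))
    (hl : (e :: w).getLast? ≠ some false) :
    Position k e (run (e :: w)) (blocks (e :: w)) (act k (ev k (e :: w)) (base k)) := by
  have := position_ev (z := base k) (c := 0) e w hw fun l hl' => by
    obtain rfl : l = true := by cases l <;> simp_all
    have h := halfFun_eq_of_arc_add (x := base k) (n := 0) (c := 1) rfl (by omega) (by omega)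
    show _ = _
    rw [gen_true, act_s, Line.arc_shift, h.1, if_pos rfl]
    push_cast; ring
  rwa [zero_add] at this

/-- The points of the line that avoid the exceptional digits. -/
def IsRegular (x : Line k) : Prop :=
  ∀ n, 1 ≤ (ofLex x.digits n : ℕ) ∧ (ofLex x.digits n : ℕ) ≤ 2 * k

theorem IsRegular.halfFun {x : Line k} (h : IsRegular x) : IsRegular (Line.halfFun x) := by
  have h0 : 1 ≤ (x.digits.head : ℕ) ∧ (x.digits.head : ℕ) ≤ 2 * k := h 0
  by_cases hx : x.arc % (2 * k + 1) = 0
  · rw [Line.halfFun_mid x hx (by omega) (by omega)]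
    exact fun n => h (n + 1)
  · obtain ⟨d, hd, e⟩ := Line.halfFun_out x hx
    have h0 := Int.emod_nonneg x.arc (show (2 * k + 1 : ℤ) ≠ 0 by omega)
    have h1 := Int.emod_lt_of_pos x.arc (show (0 : ℤ) < 2 * k + 1 by omega)
    rw [e]
    intro n
    cases n with
    | zero => exact (show 1 ≤ (d : ℕ) ∧ (d : ℕ) ≤ 2 * k by omega)
    | succ n => exact h n

theorem isRegular_act_base (hk : 1 ≤ k) (g : DihedralArtin (2 * k + 1)) :
    IsRegular (act k g (base k)) := by
  have key : ∀ w, IsRegular (act k (ev k w) (base k)) := by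
    intro w
    induction w with
    | nil =>
      intro n
      show 1 ≤ ((1 : Fin (2 * k + 2)) : ℕ) ∧ ((1 : Fin (2 * k + 2)) : ℕ) ≤ 2 * k
      simp; omega
    | cons e w ih =>
      rw [ev_cons, map_mul, RelIso.mul_apply]
      cases e
      · rw [gen_false, act_t]; exact IsRegular.halfFun (x := Line.shift (-1) _) ih
      · rw [gen_true, act_s]; exact ih.halfFun
  obtain ⟨n, hn⟩ := exists_mul_Δ_pow_mem g
  obtain ⟨w, hw⟩ := mem_M_iff.1 hn
  have := key w
  rw [hw, map_mul, RelIso.mul_apply, ← zpow_natCast, act_Δ_zpow_apply, act_shift] at this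
  exact this

/-- The number of full turns that separate the base point from its image, rounded down. -/
noncomputable def level (g : DihedralArtin (2 * k + 1)) : ℤ :=
  ((act k g (base k)).arc - 1) / (2 * k + 1)

/-- As the digits of `act k g (base k)` are at least `1`, the arc number suffices to compare this
point with a translate of the base point. -/
theorem le_level_iff (hk : 1 ≤ k) (g : DihedralArtin (2 * k + 1)) (n : ℤ) :
    n ≤ level g ↔ Line.shift ((2 * k + 1) * n) (base k) ≤ act k g (base k) := by
  have hr := isRegular_act_base hk g
  rw [level, Int.le_ediv_iff_mul_le (by omega), ← not_lt (b := Line.shift _ _), Line.lt_iff]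
  have : ¬ (act k g (base k)).digits < (base k).digits := by
    rintro ⟨i, -, hi⟩
    have h1 := (hr i).1
    have h2 : ((ofLex (act k g (base k)).digits i : Fin _) : ℕ) <
      ((1 : Fin (2 * k + 2)) : ℕ) := hi
    rw [Fin.val_one] at h2
    omega
  rw [Line.digits_shift, Line.arc_shift, show (base k).arc = 1 from rfl, mul_comm n]
  constructor
  · rintro h (h' | h')
    · omega
    · exact this h'.2
  · intro h
    by_contra h'
    exact h (Or.inl (by omega))

theorem level_lt_iff (hk : 1 ≤ k) (g : DihedralArtin (2 * k + 1)) (n : ℤ) :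
    level g < n ↔ act k g (base k) < Line.shift ((2 * k + 1) * n) (base k) := by
  rw [← not_le, le_level_iff hk, not_le]

theorem shift_shift (a b : ℤ) (x : Line k) :
    Line.shift a (Line.shift b x) = Line.shift (b + a) x := by
  ext
  · simp [add_assoc]
  · rfl

theorem shift_lt_shift {a : ℤ} {x y : Line k} : Line.shift a x < Line.shift a y ↔ x < y := by
  simp [Line.lt_iff]

theorem shift_le_shift {a : ℤ} {x y : Line k} : Line.shift a x ≤ Line.shift a y ↔ x ≤ y := by
  rw [← not_lt, shift_lt_shift, not_lt]

theorem le_level_mul (hk : 1 ≤ k) (g h : DihedralArtin (2 * k + 1)) :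
    level g + level h ≤ level (g * h) := by
  rw [le_level_iff hk, map_mul, RelIso.mul_apply]
  have h₁ := (le_level_iff hk g _).1 le_rfl
  have h₂ := (act k g).monotone ((le_level_iff hk h _).1 le_rfl)
  rw [act_shift] at h₂
  refine le_trans ?_ h₂
  rw [mul_add, ← shift_shift, shift_le_shift]
  exact h₁

theorem level_mul_le (hk : 1 ≤ k) (g h : DihedralArtin (2 * k + 1)) :
    level (g * h) ≤ level g + level h + 1 := by
  rw [← Int.lt_add_one_iff, level_lt_iff hk, map_mul, RelIso.mul_apply]
  have h₁ := (level_lt_iff hk g _).1 (lt_add_one _)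
  have h₂ := (act k g).strictMono ((level_lt_iff hk h _).1 (lt_add_one _))
  rw [act_shift] at h₂
  refine h₂.trans ?_
  rw [show level g + level h + 1 + 1 = (level g + 1) + (level h + 1) by ring,
    mul_add _ (level g + 1), ← shift_shift, shift_lt_shift]
  exact h₁

theorem level_of_act_eq {g : DihedralArtin (2 * k + 1)} {n : ℤ}
    (h : act k g (base k) = Line.shift ((2 * k + 1) * n) (base k)) : level g = n := by
  rw [level, h, Line.arc_shift, show (base k).arc = 1 from rfl, add_sub_cancel_left]
  exact Int.mul_ediv_cancel_left _ (by omega)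

theorem level_mul_of_right {g h : DihedralArtin (2 * k + 1)} {n : ℤ}
    (hh : act k h (base k) = Line.shift ((2 * k + 1) * n) (base k)) :
    level (g * h) = level g + n := by
  rw [level, map_mul, RelIso.mul_apply, hh, act_shift, Line.arc_shift, level, add_sub_right_comm]
  exact Int.add_mul_ediv_left _ _ (by omega)

theorem level_mul_of_left (hk : 1 ≤ k) {g h : DihedralArtin (2 * k + 1)} {n : ℤ}
    (hg : act k g (base k) = Line.shift ((2 * k + 1) * n) (base k)) :
    level (g * h) = n + level h := by
  refine eq_of_forall_le_iff fun i => ?_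
  rw [le_level_iff hk, map_mul, RelIso.mul_apply, show i = n + (i - n) by ring, mul_add,
    ← shift_shift, ← hg, ← act_shift, (act k g).le_iff_le, ← le_level_iff hk]
  omega

/-- Inversion turns rounding down into rounding up. -/
theorem level_inv (hk : 1 ≤ k) {g : DihedralArtin (2 * k + 1)}
    (hg : ∀ n : ℤ, act k g (base k) ≠ Line.shift ((2 * k + 1) * n) (base k)) :
    level g⁻¹ = -level g - 1 := by
  refine eq_of_forall_le_iff fun i => ?_
  rw [le_level_iff hk, ← (act k g).le_iff_le, ← RelIso.mul_apply, ← map_mul, mul_inv_cancel,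
    map_one, RelIso.one_apply, act_shift]
  have : Line.shift ((2 * k + 1) * i) (act k g (base k)) ≤ base k ↔
      act k g (base k) ≤ Line.shift ((2 * k + 1) * (-i)) (base k) := by
    rw [← shift_le_shift (a := (2 * k + 1) * (-i)), shift_shift, mul_neg, add_neg_cancel]
    have h0 : ∀ x : Line k, Line.shift 0 x = x := fun x => by ext <;> simp
    rw [h0]
  rw [this, le_iff_lt_or_eq, or_iff_left (hg _), ← level_lt_iff hk]
  omega

theorem level_mul_Δ_zpow (a : DihedralArtin (2 * k + 1)) (j : ℤ) :
    level (a * (Ω _ ^ 2) ^ j) = level a + (2 * k - 1) * j :=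
  level_mul_of_right (act_Δ_zpow_apply j _)

theorem blocks_eq_level (hk : 1 ≤ k) {e : Bool} {w : List Bool} (hw : IsReduced k (e :: w))
    (hl : (e :: w).getLast? ≠ some false) :
    (blocks (e :: w) : ℤ) = level (ev k (e :: w)) + 1 := by
  have h := position_base hk hw hl
  have h₁ := hw.run_lt
  have h₂ := run_pos (w := e :: w) (by simp)
  have key : ∀ a b : ℤ, 0 ≤ b → b < 2 * k + 1 → ((2 * k + 1) * a + b) / (2 * k + 1) = a := by
    intro a b hb hb'
    rw [Int.mul_add_ediv_left _ _ (by omega), Int.ediv_eq_zero_of_lt hb hb', add_zero]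
  cases e
  · rw [level, h.1, show ((2 * k + 1) * ((blocks (false :: w) : ℕ) : ℤ) - 1 : ℤ) =
      (2 * k + 1) * ((blocks (false :: w) : ℕ) - 1) + 2 * k by ring, key _ _ (by omega) (by omega)]
    ring
  · rw [level, show _ = _ from h, add_sub_assoc, key _ _ (by omega) (by omega)]
    ring

theorem dpt_of_mem (hk : 1 ≤ k) {a : DihedralArtin (2 * k + 1)} (ha : a ∈ (pair (2 * k + 1)).M₁) :
    (pair (2 * k + 1)).dpt a = 0 := by
  obtain ⟨n, rfl⟩ := ha
  have := dpt_ev_mul_t_pow hk (u := []) n trivial (by simp)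
  rwa [ev_nil, one_mul] at this

/-- The depth is determined by the action on the line. -/
theorem dpt_of_notMem (hk : 1 ≤ k) {a : DihedralArtin (2 * k + 1)}
    (ha : a ∈ (pair (2 * k + 1)).M) (ha' : a ∉ (pair (2 * k + 1)).M₁) :
    ((pair (2 * k + 1)).dpt a : ℤ) = level a + 1 := by
  obtain ⟨u, n, h₁, h₂, rfl⟩ := exists_eq_ev_mul_t_pow a ha
  rw [dpt_ev_mul_t_pow hk n h₁ h₂]
  have hn : act k (t _ ^ n) (base k) = Line.shift ((2 * k + 1) * 0) (base k) := by
    rw [act_t_pow_base hk]; ext <;> simp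
  rw [level_mul_of_right hn, add_zero]
  cases u with
  | nil => exact absurd ⟨n, by simp⟩ ha'
  | cons e w => exact blocks_eq_level hk h₁ h₂

/-! ### The stabilizer of the base point -/

theorem θ_eq : (pair (2 * k + 1)).θ = (s _ * t _) ^ k * (t _ * s _) ^ k := by
  have h₁ := altProd_two_mul_add_one (gen k true) (gen k false) k
  have h₂ := altProd_two_mul_add_one (gen k false) (gen k true) k
  have e₁ := altProd_gen (k := k) true
  have e₂ := altProd_gen (k := k) false
  rw [Bool.not_true, h₁, altProd_two_mul] at e₁
  rw [Bool.not_false, h₂, altProd_two_mul] at e₂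
  have e₃ := gen_mul_Ω (k := k) true
  show Ω _ ^ 2 * (t _ ^ 2)⁻¹ = _
  simp only [gen_true, gen_false, Bool.not_true] at e₁ e₂ e₃
  rw [mul_inv_eq_iff_eq_mul, pow_two (t _), ← mul_assoc, mul_assoc (_ ^ k) (_ ^ k), e₂, mul_assoc,
    ← e₃, ← mul_assoc, e₁, pow_two]

theorem θ_pow (j : ℕ) :
    (pair (2 * k + 1)).θ ^ j = (Ω _ ^ 2) ^ (j : ℤ) * t _ ^ (-2 * j : ℤ) := by
  have : Commute (Ω (2 * k + 1) ^ 2) (t (2 * k + 1) ^ 2)⁻¹ := Δ_mul_comm _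
  show (Ω _ ^ 2 * (t _ ^ 2)⁻¹) ^ j = _
  rw [this.mul_pow, zpow_natCast, mul_right_inj, zpow_mul, zpow_natCast, zpow_neg]
  norm_cast

theorem act_θ_pow_base (hk : 1 ≤ k) (j : ℕ) : act k ((pair (2 * k + 1)).θ ^ j) (base k) =
    Line.shift ((2 * k + 1) * ((2 * k - 1) * j)) (base k) := by
  rw [θ_pow, map_mul, RelIso.mul_apply, act_t_zpow_base hk, act_Δ_zpow_apply]

theorem isReduced_drop {w : List Bool} (h : IsReduced k w) (n : ℕ) : IsReduced k (w.drop n) := by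
  rw [← List.take_append_drop n w] at h
  exact h.of_append.2

theorem getLast?_drop_ne {w : List Bool} {e : Bool} (h : w.getLast? ≠ some e) (n : ℕ) :
    (w.drop n).getLast? ≠ some e := by
  rw [List.getLast?_drop]
  split_ifs
  · simp
  · exact h

/-- A reduced word that does not end in `t` and that moves the base point by full turns is
a power of `θ`: its position forces it to start with `(st)^k (ts)^k`. -/
theorem exists_eq_θ_pow (hk : 1 ≤ k) (u : List Bool) (hu : IsReduced k u)
    (hl : u.getLast? ≠ some false) (n : ℤ)
    (h : act k (ev k u) (base k) = Line.shift ((2 * k + 1) * n) (base k)) :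
    ∃ j : ℕ, ev k u = (pair (2 * k + 1)).θ ^ j := by
  induction hlen : u.length using Nat.strong_induction_on generalizing u n with
  | _ l ih =>
  subst hlen
  cases u with
  | nil => exact ⟨0, by simp⟩
  | cons e w =>
  have hp := position_base hk hu hl
  rw [h] at hp
  have h₁ := run_pos (w := e :: w) (by simp)
  have h₂ := hu.run_lt
  have ha := hp.arc_emod h₁ h₂
  rw [Line.arc_shift, show (base k).arc = 1 from rfl, Int.add_mul_emod_self_left,
    Int.emod_eq_of_lt (by omega) (by omega)] at ha
  obtain ⟨rfl, hr⟩ : e = true ∧ run (e :: w) = 2 * k := by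
    cases e <;> simp at ha
    exact ⟨rfl, by omega⟩
  -- the first factor `(st)^k` acts as a rotation
  have hv := ev_eq_altProd_mul (k := k) (2 * k) true w hr.ge
  have hv₁ := isReduced_drop hu (2 * k)
  have hv₂ := getLast?_drop_ne hl (2 * k)
  have hlen₁ : ((true :: w).drop (2 * k)).length < (true :: w).length := by
    rw [List.length_drop, List.length_cons]; omega
  generalize (true :: w).drop (2 * k) = v at hv hv₁ hv₂ hlen₁
  rw [altProd_two_mul] at hv
  simp only [gen_true, Bool.not_true, gen_false] at hv
  have hx := h
  rw [hv, map_mul, RelIso.mul_apply, map_pow, act_s_mul_t, ← zpow_natCast, ← zpow_mul,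
    Line.rot_zpow_apply] at hx
  have hx' : act k (ev k v) (base k) = Line.shift ((2 * k + 1) * (n - k) + 2 * k) (base k) := by
    have := congrArg (Line.shift (-((2 * k - 1) * k))) hx
    rw [shift_shift, shift_shift, add_neg_cancel] at this
    rw [show ((2 * k + 1) * (n - k) + 2 * k : ℤ) = (2 * k + 1) * n + -((2 * k - 1) * k) by ring,
      ← this]
    ext <;> simp
  cases v with
  | nil =>
    have := congrArg Line.arc hx'
    rw [ev_nil, map_one, RelIso.one_apply, Line.arc_shift, show (base k).arc = 1 from rfl] at this
    have h₃ : (2 * k : ℤ) % (2 * k + 1) = 0 := by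
      rw [← Int.mul_add_emod_self_left (2 * k + 1) (n - k), show
        ((2 * k + 1) * (n - k) + 2 * k : ℤ) = 0 by linarith, Int.zero_emod]
    rw [Int.emod_eq_of_lt (by omega) (by omega)] at h₃
    omega
  | cons e v =>
  have hp' := position_base hk hv₁ hv₂
  rw [hx'] at hp'
  have h₃ := run_pos (w := e :: v) (by simp)
  have h₄ := hv₁.run_lt
  have ha' := hp'.arc_emod h₃ h₄
  rw [Line.arc_shift, show (base k).arc = 1 from rfl,
    show (1 + ((2 * k + 1) * (n - k) + 2 * k) : ℤ) = (2 * k + 1) * (n - k + 1) by ring,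
    Int.mul_emod_right] at ha'
  obtain rfl : e = false := by
    cases e
    · rfl
    · simp at ha'; omega
  have hr' : run (false :: v) = 2 * k := by
    have h₅ := hp'.2
    rw [Line.digits_shift, head_base] at h₅
    omega
  have hw := ev_eq_altProd_mul (k := k) (2 * k) false v hr'.ge
  have hw₁ := isReduced_drop hv₁ (2 * k)
  have hw₂ := getLast?_drop_ne hv₂ (2 * k)
  have hlen₂ : ((false :: v).drop (2 * k)).length < (false :: v).length := by
    rw [List.length_drop, List.length_cons]; omega
  generalize (false :: v).drop (2 * k) = u at hw hw₁ hw₂ hlen₂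
  rw [altProd_two_mul] at hw
  simp only [gen_true, Bool.not_false, gen_false] at hw
  rw [hw, ← mul_assoc, ← θ_eq] at hv
  have hu' : act k (ev k u) (base k) =
      Line.shift ((2 * k + 1) * (n - (2 * k - 1))) (base k) := by
    apply (act k (pair (2 * k + 1)).θ).injective
    have := act_θ_pow_base hk 1
    rw [pow_one] at this
    rw [act_shift, this, ← RelIso.mul_apply, ← map_mul, ← hv, h, shift_shift]
    congr 1; push_cast; ring
  obtain ⟨j, hj⟩ := ih _ (hlen₂.trans hlen₁) u hw₁ hw₂ _ hu' rfl
  exact ⟨j + 1, by rw [hv, hj, pow_succ']⟩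


theorem exists_eq_θ_pow_mul (hk : 1 ≤ k) {a : DihedralArtin (2 * k + 1)}
    (ha : a ∈ (pair (2 * k + 1)).M) {n : ℤ}
    (h : act k a (base k) = Line.shift ((2 * k + 1) * n) (base k)) :
    ∃ j i : ℕ, a = (pair (2 * k + 1)).θ ^ j * t _ ^ i ∧ n = (2 * k - 1) * j := by
  obtain ⟨u, i, h₁, h₂, rfl⟩ := exists_eq_ev_mul_t_pow a ha
  rw [map_mul, RelIso.mul_apply, act_t_pow_base hk] at h
  obtain ⟨j, hj⟩ := exists_eq_θ_pow hk u h₁ h₂ n h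
  refine ⟨j, i, by rw [hj], ?_⟩
  rw [hj, act_θ_pow_base hk] at h
  have := congrArg Line.arc h
  rw [Line.arc_shift, Line.arc_shift, add_right_inj] at this
  exact (mul_left_cancel₀ (by omega) this).symm

theorem mem_ThetaBar_of_act_eq (hk : 1 ≤ k) {a : DihedralArtin (2 * k + 1)}
    (ha : a ∈ (pair (2 * k + 1)).M) {n : ℤ}
    (h : act k a (base k) = Line.shift ((2 * k + 1) * n) (base k)) :
    a ∈ (pair (2 * k + 1)).ThetaBar := by
  obtain ⟨j, i, hj, -⟩ := exists_eq_θ_pow_mul hk ha h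
  cases j with
  | zero => exact Or.inr ⟨i, by simp [hj]⟩
  | succ j => exact Or.inl ⟨ha, j + 1, by omega, _, ⟨i, rfl⟩, hj⟩

theorem act_eq_of_mem_Theta (hk : 1 ≤ k) {a : DihedralArtin (2 * k + 1)}
    (ha : a ∈ (pair (2 * k + 1)).Theta) :
    ∃ n : ℤ, 0 < n ∧ act k a (base k) = Line.shift ((2 * k + 1) * n) (base k) := by
  obtain ⟨-, j, hj, _, ⟨i, rfl⟩, rfl⟩ := ha
  refine ⟨(2 * k - 1) * j, by apply mul_pos <;> omega, ?_⟩
  show act k (_ * t _ ^ i) _ = _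
  rw [map_mul, RelIso.mul_apply, act_t_pow_base hk, act_θ_pow_base hk]

theorem act_eq_of_mem_M₁ (hk : 1 ≤ k) {a : DihedralArtin (2 * k + 1)}
    (ha : a ∈ (pair (2 * k + 1)).M₁) : act k a (base k) = base k := by
  obtain ⟨i, rfl⟩ := ha
  exact act_t_pow_base hk i

theorem shift_mul_zero (x : Line k) : Line.shift ((2 * k + 1) * 0) x = x := by
  ext <;> simp

theorem act_base_eq_iff (hk : 1 ≤ k) (g : DihedralArtin (2 * k + 1)) :
    act k g (base k) = base k ↔ g ∈ (pair (2 * k + 1)).G₁ := by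
  constructor
  · intro h
    obtain ⟨n, hn⟩ := exists_mul_Δ_pow_mem g
    obtain ⟨j, i, hj, hj'⟩ := exists_eq_θ_pow_mul hk hn (n := (2 * k - 1) * n) (by
      rw [← zpow_natCast, map_mul, RelIso.mul_apply, act_Δ_zpow_apply, act_shift, h])
    obtain rfl : n = j := by exact_mod_cast mul_left_cancel₀ (by omega) hj'
    rw [← zpow_natCast, θ_pow, mul_assoc, (Commute.zpow_left (Δ_mul_comm _) _ : Commute _ _).eq,
      mul_left_inj] at hj
    rw [hj]
    exact Subgroup.mul_mem _ (Subgroup.zpow_mem _ (Subgroup.mem_zpowers _) _)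
      (Subgroup.pow_mem _ (Subgroup.mem_zpowers _) _)
  · rintro ⟨i, rfl⟩
    exact act_t_zpow_base hk i

/-! ### The parabolic substructures -/

theorem mem_M_conj_Ω {a : DihedralArtin (2 * k + 1)} (ha : a ∈ (pair (2 * k + 1)).M) :
    Ω _ * a * (Ω _)⁻¹ ∈ (pair (2 * k + 1)).M := by
  obtain ⟨w, rfl⟩ := mem_M_iff.1 ha
  rw [Ω_mul_ev, mul_inv_cancel_right]
  exact ev_mem _

/-- A positive element `Δ t ^ (-i)` moves the base point by `ζ` full turns, hence is `θ t ^ l` with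
`l = 2 - i`. -/
theorem leR_gen_pow_Δ_iff (hk : 1 ≤ k) (e : Bool) (i : ℕ) :
    LeR (pair (2 * k + 1)).M (gen k e ^ i) (Ω _ ^ 2) ↔ i ≤ 2 := by
  have h₂ : Ω _ ^ 2 * (gen k e ^ 2)⁻¹ ∈ (pair (2 * k + 1)).M := by
    have := Submonoid.mul_mem _ (Ω_mul_inv_gen_mem (k := k) (!e)) (Ω_mul_inv_gen_mem e)
    have hc : (gen k !e)⁻¹ * Ω _ = Ω _ * (gen k e)⁻¹ := by
      rw [inv_mul_eq_iff_eq_mul, ← mul_assoc, gen_mul_Ω, Bool.not_not, mul_inv_cancel_right]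
    rw [mul_assoc, ← mul_assoc _⁻¹, hc, ← mul_assoc, ← mul_assoc, mul_assoc _ _⁻¹,
      ← mul_inv_rev, ← pow_two, ← pow_two] at this
    exact this
  constructor
  · intro h
    by_contra hi
    -- it suffices to consider `t`, since conjugation by `Ω` exchanges the generators
    have ht : Ω _ ^ 2 * (t _ ^ i)⁻¹ ∈ (pair (2 * k + 1)).M := by
      cases e
      · exact h
      · have h' := mem_M_conj_Ω h
        have hc : Ω _ * (gen k true ^ i)⁻¹ = (t _ ^ i)⁻¹ * Ω _ := by
          have : SemiconjBy (Ω _) (gen k true) (t _) := (gen_mul_Ω false).symm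
          exact (this.pow_right i).inv_right
        rw [← mul_assoc, ← Δ_mul_comm, mul_assoc _ (Ω _), hc, mul_assoc, mul_assoc,
          mul_inv_cancel, mul_one] at h'
        exact h'
    obtain ⟨j, l, hj, hj'⟩ := exists_eq_θ_pow_mul hk ht (n := (2 * k - 1) * 1) (by
      have := act_Δ_zpow_apply 1 (base k)
      rw [zpow_one] at this
      rw [map_mul, RelIso.mul_apply, ← zpow_natCast (t _), ← zpow_neg, act_t_zpow_base hk, this])
    obtain rfl : j = 1 := by exact_mod_cast (mul_left_cancel₀ (by omega) hj').symm
    have := congrArg length hj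
    rw [pow_one] at this
    change _ = length (Ω _ ^ 2 * (t _ ^ 2)⁻¹ * _) at this
    simp only [length_mul, length_inv, length_pow, length_t, length_Ω] at this
    push_cast at this
    omega
  · intro hi
    have : gen k e ^ 2 * (gen k e ^ i)⁻¹ ∈ (pair (2 * k + 1)).M := by
      rw [← pow_sub _ hi]
      exact Submonoid.pow_mem _ (gen_mem e) _
    exact leR_trans this h₂

theorem divR_gen_sq (hk : 1 ≤ k) (e : Bool) :
    DivR (pair (2 * k + 1)).M (gen k e ^ 2) = {b | ∃ i ≤ 2, b = gen k e ^ i} := by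
  ext b
  constructor
  · rintro ⟨hb, hb'⟩
    obtain ⟨i, j, -, rfl, hij⟩ := eq_pow_of_mul_eq_pow hk hb' hb (inv_mul_cancel_right _ _)
    exact ⟨j, by omega, rfl⟩
  · rintro ⟨i, hi, rfl⟩
    refine ⟨Submonoid.pow_mem _ (gen_mem e) i, ?_⟩
    rw [LeR, ← pow_sub _ hi]
    exact Submonoid.pow_mem _ (gen_mem e) _

theorem divL_gen_sq (hk : 1 ≤ k) (e : Bool) :
    DivL (pair (2 * k + 1)).M (gen k e ^ 2) = {b | ∃ i ≤ 2, b = gen k e ^ i} := by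
  ext b
  constructor
  · rintro ⟨hb, hb'⟩
    obtain ⟨i, j, rfl, -, hij⟩ := eq_pow_of_mul_eq_pow hk hb hb' (mul_inv_cancel_left _ _)
    exact ⟨i, by omega, rfl⟩
  · rintro ⟨i, hi, rfl⟩
    refine ⟨Submonoid.pow_mem _ (gen_mem e) i, ?_⟩
    rw [LeL, ((Commute.refl (gen k e)).pow_pow i 2).inv_left.eq, ← pow_sub _ hi]
    exact Submonoid.pow_mem _ (gen_mem e) _

theorem isParabolicSubstructure_gen (hk : 1 ≤ k) (e : Bool) :
    IsParabolicSubstructure (pair (2 * k + 1)).M (Ω _ ^ 2) (Subgroup.zpowers (gen k e))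
      (Submonoid.powers (gen k e)) (gen k e ^ 2) where
  balanced := ⟨Submonoid.pow_mem _ (gen_mem e) _, by rw [divR_gen_sq hk, divL_gen_sq hk]⟩
  subgroup_eq := by
    rw [divR_gen_sq hk]
    refine le_antisymm ?_ ((Subgroup.closure_le _).2 ?_)
    · rw [Subgroup.zpowers_le]
      exact Subgroup.subset_closure ⟨1, by omega, by rw [pow_one]⟩
    · rintro _ ⟨i, -, rfl⟩
      exact Subgroup.npow_mem_zpowers _ _
  submonoid_eq := by
    rw [divR_gen_sq hk]
    refine le_antisymm ?_ (Submonoid.closure_le.2 ?_)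
    · rw [Submonoid.powers_le]
      exact Submonoid.subset_closure ⟨1, by omega, by rw [pow_one]⟩
    · rintro _ ⟨i, -, rfl⟩
      exact ⟨i, rfl⟩
  div_eq := by
    rw [divR_gen_sq hk]
    ext b
    constructor
    · rintro ⟨i, hi, rfl⟩
      exact ⟨⟨Submonoid.pow_mem _ (gen_mem e) _, (leR_gen_pow_Δ_iff hk e i).2 hi⟩, i, rfl⟩
    · rintro ⟨⟨-, h⟩, i, rfl⟩
      exact ⟨i, (leR_gen_pow_Δ_iff hk e i).1 h, rfl⟩

theorem powers_gen_ne (hk : 1 ≤ k) (e : Bool) :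
    Submonoid.powers (gen k e) ≠ (pair (2 * k + 1)).M := by
  intro h
  obtain ⟨n, hn⟩ : gen k (!e) ∈ Submonoid.powers (gen k e) := h ▸ gen_mem _
  have hn : gen k e ^ n = gen k !e := hn
  have h₁ : ev k [!e] = ev k (List.replicate n e) := by
    rw [ev_replicate, hn]; simp
  have h₂ := eq_of_ev_eq hk (isReduced_replicate hk n e) h₁
  have h₃ : (!e) ∈ List.replicate n e := h₂ ▸ List.mem_singleton_self _
  have := List.eq_of_mem_replicate h₃
  cases e <;> simp at this

theorem isAdmissible (hk : 1 ≤ k) : (pair (2 * k + 1)).IsAdmissible where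
  garside := isGarsideStructure hk
  parabolic_H := isParabolicSubstructure_gen hk true
  parabolic_G₁ := isParabolicSubstructure_gen hk false
  N_ne := powers_gen_ne hk true
  M₁_ne := powers_gen_ne hk false
  generate := by
    refine le_antisymm (Submonoid.closure_le.2 (Set.union_subset ?_ ?_))
      (Submonoid.closure_le.2 ?_)
    · exact powers_gen_le true
    · exact powers_gen_le false
    · rintro _ (rfl | rfl)
      · exact Submonoid.subset_closure (Or.inl ⟨1, pow_one _⟩)
      · exact Submonoid.subset_closure (Or.inr ⟨1, pow_one _⟩)
  Δ_central := Δ_mul_comm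
  Δ₁_central := by
    rintro _ ⟨n, rfl⟩
    exact (((Commute.refl (t (2 * k + 1))).pow_left 2).zpow_right n).eq

/-! ### Conditions A and B -/

theorem level_of_mem_M₁ (hk : 1 ≤ k) {a : DihedralArtin (2 * k + 1)}
    (ha : a ∈ (pair (2 * k + 1)).M₁) : level a = 0 :=
  level_of_act_eq (by rw [act_eq_of_mem_M₁ hk ha, shift_mul_zero])

theorem dpt_Δ_pow (hk : 1 ≤ k) {j : ℕ} (hj : 1 ≤ j) :
    ((pair (2 * k + 1)).dpt ((pair (2 * k + 1)).Δ ^ j) : ℤ) = (2 * k - 1) * j + 1 := by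
  have hl : level ((pair (2 * k + 1)).Δ ^ j) = (2 * k - 1) * j :=
    level_of_act_eq (by rw [← act_Δ_zpow_apply, zpow_natCast]; rfl)
  rw [dpt_of_notMem (a := (pair (2 * k + 1)).Δ ^ j) hk (Δ_pow_mem j), hl]
  intro h
  rw [level_of_mem_M₁ hk h] at hl
  have : (0 : ℤ) < (2 * k - 1) * j := mul_pos (by omega) (by omega)
  omega

theorem conditionA (hk : 1 ≤ k) : (pair (2 * k + 1)).ConditionA (2 * k - 1) := by
  refine ⟨by omega, fun j hj => ?_⟩
  have := dpt_Δ_pow hk hj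
  zify
  rw [this]
  push_cast [show 1 ≤ 2 * k by omega]
  ring

/-- Away from `M₁` the depth is `level + 1`, so `ε` measures the error in the additivity of `level`,
corrected by the number of elements among `a`, `b`, `c` that lie in `M₁`. -/
theorem conditionB (hk : 1 ≤ k) : (pair (2 * k + 1)).ConditionB (2 * k - 1) := by
  refine ⟨by omega, fun a b ha hb hab c r hc => ?_⟩
  have ha := ha.1
  have hb := hb.1
  have hcM := hc.1.1
  have hz : ((2 * k - 1 : ℕ) : ℤ) = 2 * k - 1 := by omega
  have hl : level (a * b) = level c + (2 * k - 1) * r := by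
    rw [hc.2]; exact level_mul_Δ_zpow c r
  rw [hz]
  have h₁ := le_level_mul hk a b
  have h₂ := level_mul_le hk a b
  -- at most one of the factors moves the base point by full turns
  have hstab : ∀ {n n' : ℤ}, act k a (base k) = Line.shift ((2 * k + 1) * n) (base k) →
      act k b (base k) = Line.shift ((2 * k + 1) * n') (base k) → False := fun e e' =>
    hab ⟨mem_ThetaBar_of_act_eq hk ha e, mem_ThetaBar_of_act_eq hk hb e'⟩
  have hM₁ : ∀ {x}, x ∈ (pair (2 * k + 1)).M₁ →
      act k x (base k) = Line.shift ((2 * k + 1) * 0) (base k) := fun hx => by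
    rw [act_eq_of_mem_M₁ hk hx, shift_mul_zero]
  have hΘ : ∀ {x}, x ∈ (pair (2 * k + 1)).M₁ → x ∉ (pair (2 * k + 1)).Theta := fun hx hx' => by
    obtain ⟨n, hn, e⟩ := act_eq_of_mem_Theta hk hx'
    have := level_of_act_eq e
    rw [level_of_mem_M₁ hk hx] at this
    omega
  have habc : c ∈ (pair (2 * k + 1)).M₁ →
      act k (a * b) (base k) = Line.shift ((2 * k + 1) * ((2 * k - 1) * r)) (base k) := fun h => by
    rw [hc.2]
    show act k (c * (Ω _ ^ 2) ^ r) _ = _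
    rw [map_mul, RelIso.mul_apply, act_Δ_zpow_apply, act_shift, act_eq_of_mem_M₁ hk h]
  by_cases hA : a ∈ (pair (2 * k + 1)).M₁
  · -- `a` is a power of `t`: the levels add up, and none of the exceptional cases occurs
    have hB : b ∉ (pair (2 * k + 1)).M₁ := fun hB => hstab (hM₁ hA) (hM₁ hB)
    have hC : c ∉ (pair (2 * k + 1)).M₁ := fun hC => by
      refine hstab (hM₁ hA) (n' := (2 * k - 1) * r) ?_
      apply (act k a).injective
      rw [act_shift, act_eq_of_mem_M₁ hk hA, ← RelIso.mul_apply, ← map_mul, habc hC]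
    have h₃ := level_mul_of_left hk (h := b) (hM₁ hA)
    refine ⟨0, Or.inl rfl, ?_, ?_⟩
    · rw [dpt_of_mem hk hA, dpt_of_notMem hk hb hB, dpt_of_notMem hk hcM hC]
      push_cast
      linarith
    · rintro (h | h | h)
      · exact absurd h (hΘ hA)
      · obtain ⟨n, -, e⟩ := act_eq_of_mem_Theta hk h
        exact (hstab (hM₁ hA) e).elim
      · exact absurd h hC
  by_cases hB : b ∈ (pair (2 * k + 1)).M₁
  · have hC : c ∉ (pair (2 * k + 1)).M₁ := fun hC => by
      refine hstab (n := (2 * k - 1) * r) ?_ (hM₁ hB)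
      rw [← habc hC, map_mul, RelIso.mul_apply, act_eq_of_mem_M₁ hk hB]
    have h₃ := level_mul_of_right (g := a) (hM₁ hB)
    refine ⟨0, Or.inl rfl, ?_, ?_⟩
    · rw [dpt_of_mem hk hB, dpt_of_notMem hk ha hA, dpt_of_notMem hk hcM hC]
      push_cast
      linarith
    · rintro (h | h | h)
      · obtain ⟨n, -, e⟩ := act_eq_of_mem_Theta hk h
        exact (hstab e (hM₁ hB)).elim
      · exact absurd h (hΘ hB)
      · exact absurd h hC
  by_cases hC : c ∈ (pair (2 * k + 1)).M₁
  · -- `a` and `b⁻¹` differ by a full turn, and `b` does not move the base point by full turns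
    have h₃ : level a = (2 * k - 1) * r + level b⁻¹ := by
      rw [← level_mul_of_left hk (habc hC), mul_inv_cancel_right]
    rw [level_inv hk] at h₃
    · refine ⟨1, Or.inr rfl, ?_, fun _ => rfl⟩
      rw [dpt_of_mem hk hC, dpt_of_notMem hk ha hA, dpt_of_notMem hk hb hB]
      push_cast
      linarith
    · intro n hn
      have h₄ := habc hC
      rw [map_mul, RelIso.mul_apply, hn, act_shift] at h₄
      refine hstab (n := (2 * k - 1) * r - n) ?_ hn
      have h₅ := congrArg (Line.shift (-((2 * k + 1) * n))) h₄
      rw [shift_shift, shift_shift, add_neg_cancel] at h₅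
      rw [mul_sub, sub_eq_add_neg, ← h₅]
      ext <;> simp
  · refine ⟨level a + level b + 1 - level (a * b), by omega, ?_, ?_⟩
    · rw [dpt_of_notMem hk hcM hC, dpt_of_notMem hk ha hA, dpt_of_notMem hk hb hB]
      linarith
    · rintro (h | h | h)
      · obtain ⟨n, -, e⟩ := act_eq_of_mem_Theta hk h
        rw [level_mul_of_left hk e, level_of_act_eq e]; ring
      · obtain ⟨n, -, e⟩ := act_eq_of_mem_Theta hk h
        rw [level_mul_of_right e, level_of_act_eq e]; ring
      · exact absurd h hC

/-! ### The Dehornoy structure and the orders -/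

theorem exists_isDeltaForm (hk : 1 ≤ k) (g : DihedralArtin (2 * k + 1)) :
    ∃ a j, IsDeltaForm (pair (2 * k + 1)).M (pair (2 * k + 1)).Δ g a j := by
  have key : ∀ n : ℕ, ∀ a ∈ (pair (2 * k + 1)).M, length a ≤ n →
      ∃ b, ∃ j : ℤ, IsDeltaForm (pair (2 * k + 1)).M (pair (2 * k + 1)).Δ a b j := by
    intro n
    induction n with
    | zero =>
      intro a ha hl
      refine ⟨a, 0, ⟨ha, fun h => ?_⟩, by simp⟩
      have := length_nonneg h
      change 0 ≤ length (_ * (Ω _ ^ 2)⁻¹) at this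
      simp only [length_mul, length_inv, length_pow, length_Ω] at this
      push_cast at this hl
      omega
    | succ n ih =>
      intro a ha hl
      by_cases h : LeR (pair (2 * k + 1)).M (pair (2 * k + 1)).Δ a
      · obtain ⟨b, j, h₁, h₂⟩ := ih _ h (by
          change length (_ * (Ω _ ^ 2)⁻¹) ≤ _
          simp only [length_mul, length_inv, length_pow, length_Ω]
          push_cast at hl ⊢
          omega)
        refine ⟨b, j + 1, h₁, ?_⟩
        rw [zpow_add_one, ← mul_assoc, ← h₂, inv_mul_cancel_right]
      · exact ⟨a, 0, ⟨ha, h⟩, by simp⟩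
  obtain ⟨n, hn⟩ := exists_mul_Δ_pow_mem g
  obtain ⟨b, j, h₁, h₂⟩ := key _ _ hn (Int.self_le_toNat _)
  refine ⟨b, j - n, h₁, ?_⟩
  rw [zpow_sub, ← mul_assoc, ← h₂, zpow_natCast]
  exact (mul_inv_cancel_right _ _).symm

theorem level_nonneg (hk : 1 ≤ k) {a : DihedralArtin (2 * k + 1)}
    (ha : a ∈ (pair (2 * k + 1)).M) : 0 ≤ level a := by
  obtain ⟨w, rfl⟩ := mem_M_iff.1 ha
  induction w with
  | nil => exact (level_of_mem_M₁ hk (Submonoid.one_mem _)).ge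
  | cons e w ih =>
    have hg : level (gen k e) = 0 := by
      cases e
      · exact level_of_mem_M₁ hk ⟨1, pow_one _⟩
      · have := blocks_eq_level hk (isReduced_replicate hk 1 true) (by simp)
        simpa [blocks] using this.symm
    have := le_level_mul hk (gen k e) (ev k w)
    rw [hg, zero_add] at this
    rw [ev_cons]
    exact (ih (ev_mem w)).trans this

/-- The negative elements are those that move the base point down. -/
theorem mem_negative_iff (hk : 1 ≤ k) (g : DihedralArtin (2 * k + 1)) :
    g ∈ (pair (2 * k + 1)).negative ↔ act k g (base k) < base k := by
  rw [← shift_mul_zero (base k), act_shift, shift_mul_zero, ← level_lt_iff hk]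
  constructor
  · rintro ⟨a, j, ⟨⟨ha, -⟩, rfl⟩, hj, hd⟩
    have hz := dpt_Δ_pow hk hj
    have hl : level (a * (pair (2 * k + 1)).Δ ^ (-(j : ℤ))) = level a + (2 * k - 1) * -(j : ℤ) :=
      level_mul_Δ_zpow a _
    rw [hl]
    have hpos : (0 : ℤ) < (2 * k - 1) * j := mul_pos (by omega) (by omega)
    by_cases h : a ∈ (pair (2 * k + 1)).M₁
    · rw [level_of_mem_M₁ hk h]; linarith
    · have := dpt_of_notMem hk ha h
      have : level a < (2 * k - 1) * j := by omega
      linarith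
  · intro hneg
    obtain ⟨a, j, h⟩ := exists_isDeltaForm hk g
    have hl : level g = level a + (2 * k - 1) * j := by rw [h.2]; exact level_mul_Δ_zpow a _
    have h₀ := level_nonneg hk h.1.1
    have hj : j < 0 := by
      by_contra hj
      have : 0 ≤ (2 * k - 1) * j := mul_nonneg (by omega) (by omega)
      omega
    obtain ⟨i, rfl⟩ : ∃ i : ℕ, j = -(i : ℤ) := ⟨j.natAbs, by omega⟩
    refine ⟨a, i, h, by omega, ?_⟩
    have hz := dpt_Δ_pow hk (show 1 ≤ i by omega)
    have hpos : (0 : ℤ) < (2 * k - 1) * i := mul_pos (by omega) (by omega)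
    by_cases hm : a ∈ (pair (2 * k + 1)).M₁
    · rw [dpt_of_mem hk hm]; omega
    · have := dpt_of_notMem hk h.1.1 hm
      rw [mul_neg] at hl
      omega

theorem mem_positive_iff (hk : 1 ≤ k) (g : DihedralArtin (2 * k + 1)) :
    g ∈ (pair (2 * k + 1)).positive ↔ base k < act k g (base k) := by
  show g⁻¹ ∈ (pair (2 * k + 1)).negative ↔ _
  rw [mem_negative_iff hk, ← (act k g).lt_iff_lt, ← RelIso.mul_apply, ← map_mul, mul_inv_cancel,
    map_one, RelIso.one_apply]

theorem isDehornoyStructure (hk : 1 ≤ k) : (pair (2 * k + 1)).IsDehornoyStructure where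
  admissible := isAdmissible hk
  mul_mem α hα β hβ := by
    rw [mem_positive_iff hk] at *
    rw [map_mul, RelIso.mul_apply]
    exact hα.trans ((act k α).strictMono hβ)
  mul_mul_mem γ hγ α hα γ' hγ' := by
    rw [mem_positive_iff hk] at *
    rw [← act_base_eq_iff hk] at hγ hγ'
    rw [map_mul, map_mul, RelIso.mul_apply, RelIso.mul_apply, hγ']
    simpa only [hγ] using (act k γ).strictMono hα
  cover := by
    refine Set.eq_univ_of_forall fun g => ?_
    rcases lt_trichotomy (act k g (base k)) (base k) with h | h | h
    · exact Or.inl (Or.inr ((mem_negative_iff hk g).2 h))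
    · exact Or.inr ((act_base_eq_iff hk g).1 h)
    · exact Or.inl (Or.inl ((mem_positive_iff hk g).2 h))
  disjoint_pos_neg := Set.disjoint_left.2 fun g h h' =>
    ((mem_positive_iff hk g).1 h).asymm ((mem_negative_iff hk g).1 h')
  disjoint_pos_G₁ := Set.disjoint_left.2 fun g h h' =>
    ((mem_positive_iff hk g).1 h).ne' ((act_base_eq_iff hk g).2 h')
  disjoint_neg_G₁ := Set.disjoint_left.2 fun g h h' =>
    ((mem_negative_iff hk g).1 h).ne ((act_base_eq_iff hk g).2 h')

end DihedralArtin

/-- A subset that is closed under multiplication and that contains exactly one of `g` and `g⁻¹` for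
each `g ≠ 1` is a positive cone. -/
theorem isPositiveConeOfLeftOrder_of {G : Type*} [Group G] {P : Set G} (h₁ : 1 ∉ P)
    (hmul : ∀ g ∈ P, ∀ h ∈ P, g * h ∈ P) (htot : ∀ g, g ∈ P ∨ g = 1 ∨ g⁻¹ ∈ P) :
    IsPositiveConeOfLeftOrder P := by
  refine ⟨fun a b => a⁻¹ * b ∈ P, fun a => by simpa using h₁, fun a b c hab hbc => ?_,
    fun a b => ?_, fun a b c h => ?_, by simp⟩
  · have := hmul _ hab _ hbc
    rwa [mul_assoc, mul_inv_cancel_left] at this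
  · rcases htot (a⁻¹ * b) with h | h | h
    · exact Or.inl h
    · exact Or.inr (Or.inl (inv_mul_eq_one.1 h))
    · rw [mul_inv_rev, inv_inv] at h
      exact Or.inr (Or.inr h)
  · show (a * b)⁻¹ * (a * c) ∈ P
    rwa [mul_inv_rev, mul_assoc, inv_mul_cancel_left]

namespace DihedralArtin

variable {k : ℕ}

theorem mem_signedSet_positive_iff (hk : 1 ≤ k) (e : ℤˣ) (g : DihedralArtin (2 * k + 1)) :
    g ∈ signedSet e (pair (2 * k + 1)).positive ↔
      (e = 1 ∧ base k < act k g (base k)) ∨ (e = -1 ∧ act k g (base k) < base k) := by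
  rcases Int.units_eq_one_or e with rfl | rfl
  · simp [signedSet, mem_positive_iff hk]
  · have : g ∈ signedSet (-1) (pair (2 * k + 1)).positive ↔
        g ∈ (pair (2 * k + 1)).negative := by
      simp [signedSet, GarsidePair.positive]
    simp [this, mem_negative_iff hk]

theorem mem_signedSet_pow_iff (e : ℤˣ) (g : DihedralArtin (2 * k + 1)) :
    g ∈ signedSet e {g | ∃ n : ℕ, 1 ≤ n ∧ g = t (2 * k + 1) ^ n} ↔
      ∃ n : ℤ, 1 ≤ (e : ℤ) * n ∧ g = t _ ^ n := by
  rcases Int.units_eq_one_or e with rfl | rfl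
  · show (∃ n : ℕ, 1 ≤ n ∧ g ^ (1 : ℤ) = t (2 * k + 1) ^ n) ↔
      ∃ n : ℤ, 1 ≤ (1 : ℤ) * n ∧ g = t _ ^ n
    rw [zpow_one]
    constructor
    · rintro ⟨n, hn, rfl⟩
      exact ⟨n, by omega, by simp⟩
    · rintro ⟨n, hn, rfl⟩
      exact ⟨n.toNat, by omega, by rw [← zpow_natCast, Int.toNat_of_nonneg (by omega)]⟩
  · show (∃ n : ℕ, 1 ≤ n ∧ g ^ (-1 : ℤ) = t (2 * k + 1) ^ n) ↔
      ∃ n : ℤ, 1 ≤ (-1 : ℤ) * n ∧ g = t _ ^ n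
    rw [zpow_neg_one]
    constructor
    · rintro ⟨n, hn, h⟩
      exact ⟨-n, by omega, by rw [← inv_inv g, h]; simp⟩
    · rintro ⟨n, hn, rfl⟩
      refine ⟨(-n).toNat, by omega, ?_⟩
      rw [← zpow_natCast, Int.toNat_of_nonneg (by omega), zpow_neg]

theorem t_zpow_ne_one {n : ℤ} (hn : n ≠ 0) : t (2 * k + 1) ^ n ≠ 1 := by
  intro h
  have : length (t (2 * k + 1) ^ n) = n := by simp [length, lengthHom]
  rw [h, length_one] at this
  exact hn this.symm

theorem mem_cone_iff (hk : 1 ≤ k) (ε : ℤˣ × ℤˣ) (g : DihedralArtin (2 * k + 1)) :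
    g ∈ cone (2 * k + 1) ε ↔
      ((ε.1 = 1 ∧ base k < act k g (base k)) ∨ (ε.1 = -1 ∧ act k g (base k) < base k)) ∨
      ∃ n : ℤ, 1 ≤ (ε.2 : ℤ) * n ∧ g = t _ ^ n := by
  rw [cone, Set.mem_union, mem_signedSet_positive_iff hk, mem_signedSet_pow_iff]

theorem cone_isPositiveCone (hk : 1 ≤ k) (ε : ℤˣ × ℤˣ) :
    IsPositiveConeOfLeftOrder (cone (2 * k + 1) ε) := by
  obtain ⟨e, e'⟩ := ε
  have hne : (1 : ℤˣ) ≠ -1 := by decide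
  refine isPositiveConeOfLeftOrder_of ?_ ?_ ?_
  · rw [mem_cone_iff hk, map_one, RelIso.one_apply]
    rintro ((⟨-, h⟩ | ⟨-, h⟩) | ⟨n, hn, h⟩)
    · exact lt_irrefl _ h
    · exact lt_irrefl _ h
    · refine t_zpow_ne_one ?_ h.symm
      rintro rfl
      simp at hn
  · intro g hg h hh
    rw [mem_cone_iff hk] at *
    rw [map_mul, RelIso.mul_apply]
    rcases hg with (⟨he, hg⟩ | ⟨he, hg⟩) | ⟨n, hn, rfl⟩ <;>
      rcases hh with (⟨hf, hh⟩ | ⟨hf, hh⟩) | ⟨n', hn', rfl⟩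
    · exact Or.inl (Or.inl ⟨he, hg.trans ((act k g).strictMono hh)⟩)
    · exact absurd (he.symm.trans hf) hne
    · exact Or.inl (Or.inl ⟨he, by rwa [act_t_zpow_base hk]⟩)
    · exact absurd (hf.symm.trans he) hne
    · exact Or.inl (Or.inr ⟨he, ((act k g).strictMono hh).trans hg⟩)
    · exact Or.inl (Or.inr ⟨he, by rwa [act_t_zpow_base hk]⟩)
    · refine Or.inl (Or.inl ⟨hf, ?_⟩)
      simpa only [act_t_zpow_base hk] using (act k (t _ ^ n)).strictMono hh
    · refine Or.inl (Or.inr ⟨hf, ?_⟩)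
      simpa only [act_t_zpow_base hk] using (act k (t _ ^ n)).strictMono hh
    · exact Or.inr ⟨n + n', by rw [mul_add]; omega, by rw [zpow_add]⟩
  · intro g
    rw [mem_cone_iff hk, mem_cone_iff hk]
    have hinv : act k g⁻¹ (base k) < base k ↔ base k < act k g (base k) := by
      rw [← mem_negative_iff hk, ← mem_positive_iff hk]; rfl
    have hinv' : base k < act k g⁻¹ (base k) ↔ act k g (base k) < base k := by
      rw [← mem_negative_iff hk, ← mem_positive_iff hk]
      show g⁻¹⁻¹ ∈ (pair (2 * k + 1)).negative ↔ g ∈ (pair (2 * k + 1)).negative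
      rw [inv_inv]
    rw [hinv, hinv']
    rcases lt_trichotomy (act k g (base k)) (base k) with h | h | h
    · rcases Int.units_eq_one_or e with rfl | rfl <;> simp [h]
    · obtain ⟨n, rfl⟩ := (act_base_eq_iff hk g).1 h
      rcases lt_trichotomy ((e' : ℤ) * n) 0 with hn | hn | hn
      · exact Or.inr (Or.inr (Or.inr ⟨-n, by rw [mul_neg]; show 1 ≤ -((e' : ℤ) * n); omega,
          (zpow_neg _ _).symm⟩))
      · obtain rfl : n = 0 := by
          rcases mul_eq_zero.1 hn with h | h
          · exact absurd h (Units.ne_zero e')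
          · exact h
        exact Or.inr (Or.inl (zpow_zero _))
      · exact Or.inl (Or.inr ⟨n, hn, rfl⟩)
    · rcases Int.units_eq_one_or e with rfl | rfl <;> simp [h]

theorem base_lt_act_s (hk : 1 ≤ k) : base k < act k (s _) (base k) := by
  have h : (act k (s _) (base k)).arc = 2 * k := by
    have := position_base hk (isReduced_replicate hk 1 true) (by simp)
    simpa [Position, blocks, run] using this
  rw [Line.lt_iff, h]
  left
  show (1 : ℤ) < 2 * k
  omega

theorem cone_injective (hk : 1 ≤ k) : Function.Injective (cone (2 * k + 1)) := by
  have h₁ : ∀ ε, s _ ∈ cone (2 * k + 1) ε ↔ ε.1 = 1 := fun ε => by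
    rw [mem_cone_iff hk]
    constructor
    · rintro ((⟨h, -⟩ | ⟨-, h⟩) | ⟨n, -, h⟩)
      · exact h
      · exact absurd h (base_lt_act_s hk).asymm
      · have := base_lt_act_s hk
        rw [h, act_t_zpow_base hk] at this
        exact absurd this (lt_irrefl _)
    · exact fun h => Or.inl (Or.inl ⟨h, base_lt_act_s hk⟩)
  have h₂ : ∀ ε, t _ ∈ cone (2 * k + 1) ε ↔ ε.2 = 1 := fun ε => by
    rw [mem_cone_iff hk, act_t_base hk]
    constructor
    · rintro ((⟨-, h⟩ | ⟨-, h⟩) | ⟨n, hn, h⟩)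
      · exact absurd h (lt_irrefl _)
      · exact absurd h (lt_irrefl _)
      · obtain rfl : n = 1 := by
          by_contra hn'
          refine t_zpow_ne_one (k := k) (sub_ne_zero.2 hn') ?_
          rw [zpow_sub_one, ← h, mul_inv_cancel]
        rcases Int.units_eq_one_or ε.2 with h | h
        · exact h
        · rw [h] at hn; simp at hn
    · intro h
      exact Or.inr ⟨1, by simp [h], (zpow_one _).symm⟩
  have hu : ∀ u v : ℤˣ, (u = 1 ↔ v = 1) → u = v := by decide
  intro ε ε' h
  exact Prod.ext (hu _ _ (by rw [← h₁, ← h₁, h])) (hu _ _ (by rw [← h₂, ← h₂, h]))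

end DihedralArtin

end DehornoyOrder

theorem theorem6p1 (k : ℕ) (hk : 2 ≤ k) :
    (DehornoyOrder.DihedralArtin.pair (2 * k + 1)).IsAdmissible ∧
    (DehornoyOrder.DihedralArtin.pair (2 * k + 1)).ConditionA (2 * k - 1) ∧
    (DehornoyOrder.DihedralArtin.pair (2 * k + 1)).ConditionB (2 * k - 1) ∧
    (DehornoyOrder.DihedralArtin.pair (2 * k + 1)).IsDehornoyStructure ∧
    (∀ ε : ℤˣ × ℤˣ, DehornoyOrder.IsPositiveConeOfLeftOrder
      (DehornoyOrder.DihedralArtin.cone (2 * k + 1) ε)) ∧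
    Function.Injective (DehornoyOrder.DihedralArtin.cone (2 * k + 1)) := by
  have hk' : 1 ≤ k := by omega
  exact ⟨DehornoyOrder.DihedralArtin.isAdmissible hk', DehornoyOrder.DihedralArtin.conditionA hk',
    DehornoyOrder.DihedralArtin.conditionB hk', DehornoyOrder.DihedralArtin.isDehornoyStructure hk',
    DehornoyOrder.DihedralArtin.cone_isPositiveCone hk',
    DehornoyOrder.DihedralArtin.cone_injective hk'⟩
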